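/- Let $R$ be a commutative $\mathbb{Q}$-algebra (for instance $R=\mathbb{C}$). Let $A$ be the Clifford $R$-algebra generated by $\psi_i,\psi_i^*$ ($i\in\mathbb{Z}-\tfrac12$) with relations $[\psi_i,\psi_j]_+=[\psi_i^*,\psi_j^*]_+=0$, $[\psi_i,\psi_j^*]_+=\delta_{ij}$. Let $\mathcal F=A|0\rangle$ be the Fock module, the quotient of $A$ by the left ideal generated by the $\psi_i^*$ with $i<0$ and the $\psi_i$ with $i>0$, and let $\langle 0|\,\cdot\,|0\rangle$ be the linear form on $A$ with $\langle 0|1|0\rangle=1$ that vanishes on this left ideal and on the right ideal generated by the $\psi_i^*$ with $i>0$ and the $\psi_i$ with $i<0$. For $q\ge 1$ put $J_q=\sum_{i}{:}\psi^*_{i-q}\psi_i{:}$, and for parameters $s=(s_1,s_2,\dots)$ put $H[s]=\sum_{q\ge1}s_qJ_q$ and $e^{H[s]}=\sum_{k\ge0}H[s]^k/k!$, as operators on $\mathcal F$ (on each vector all these sums have only finitely many nonzero terms). For $n\ge1$, $\lambda=(\lambda_1\ge\dots\ge\lambda_n\ge0)$ and $\mu=(\mu_1\ge\dots\ge\mu_{n-1}\ge0)$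 put $$|\lambda;n\rangle=\psi^*_{\lambda_1+n-\frac12}\psi^*_{\lambda_2+n-\frac32}\cdots\psi^*_{\lambda_n+\frac12}|0\rangle,\qquad \langle\mu;n-1|=\langle0|\psi_{\mu_{n-1}+\frac12}\cdots\psi_{\mu_2+n-\frac52}\psi_{\mu_1+n-\frac32}.$$ For partitions $\alpha,\beta$ with at most $n$ parts, let $s_{\alpha/\beta}(x_1,\dots,x_a\mid y_1,\dots,y_b)$ be the supersymmetric skew Schur function: the sum, over all fillings of the skew diagram $\alpha/\beta$ with letters $1<\dots<a<1'<\dots<b'$ that weakly increase along rows and columns, with no unprimed letter repeated in a column and no primed letter repeated in a row, of the product of $x_i$ over the entries $i$ and $y_j$ over the entries $j'$; it is $0$ if $\beta\not\subseteq\alpha$. Let $h_k(x\mid y)=\sum_{i=0}^k h_i(x)e_{k-i}(y)$, and $h_k(x\mid y)=0$ for $k<0$. **Proposition.** Let $x,y\in R$ and $s_q=\frac1q\left(x^q-(-y)^q\right)$ for $q\ge1$. For all $n\ge 1$, $\lambda$, $\mu$ as above, with $\mu_n:=0$, $$\langle\mu;n-1|\,e^{H[s]}\,\psi_{-1/2}\,|\lambda;n\rangle=(-1)^n\,s_{(\lambda+(1^n))/\mu}(x\mid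 y),$$ where $\lambda+(1^n)=(\lambda_1+1,\dots,\lambda_n+1)$, and $$s_{(\lambda+(1^n))/\mu}(x\mid y)=\det_{1\le p,q\le n}h_{\lambda_q-\mu_p-q+p+1}(x\mid y).$$ In particular, if $y=tx$ with $t\in R$, then $s_q=s_q^+(t):=\frac1q\left(1-(-t)^q\right)x^q$ for all $q\ge1$. -/

import Mathlib

/-!
Free fermions are located at half-integers. Throughout, the integer index `k` stands for the
half-integer `k - 1/2`; so `1 ≤ k` means "positive position", `k ≤ 0` means "negative position",
and the position `-1/2` is the index `0`. The base ring `R` is a commutative ring (a commutative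
`ℚ`-algebra as soon as exponentials are involved); `R = ℂ` is the classical case.
-/

noncomputable section

namespace Fermion

variable (R : Type*) [CommRing R]

/-- The space `𝒲 = ⨁ R ψ_k ⊕ ⨁ R ψ*_k` of free fermions: the first component holds the
coefficients of the `ψ_k`, the second one those of the `ψ*_k`. -/
abbrev FreeFermions : Type _ := (ℤ →₀ R) × (ℤ →₀ R)

variable {R}

/-- The bilinear form `(a, b) ↦ ∑ k, c k * a k * b k` on finitely supported sequences. -/
def pairing (c : ℤ → R) : (ℤ →₀ R) →ₗ[R] (ℤ →₀ R) →ₗ[R] R :=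
  Finsupp.linearCombination R (fun k => c k • (Finsupp.lapply k : (ℤ →₀ R) →ₗ[R] R))

variable (R)

/-- The quadratic form `∑ a_k ψ_k + ∑ b_k ψ*_k ↦ ∑ a_k b_k`. -/
def quadForm : QuadraticForm R (FreeFermions R) :=
  LinearMap.BilinMap.toQuadraticMap
    ((pairing (fun _ => (1 : R))).compl₁₂ (LinearMap.fst R _ _) (LinearMap.snd R _ _))

/-- The Clifford algebra `A` generated by the fermions. -/
abbrev Alg : Type _ := CliffordAlgebra (quadForm R)

variable {R}

/-- The annihilation operator `ψ` at position `k - 1/2`, as an element of `A`. -/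
def psi (k : ℤ) : Alg R := CliffordAlgebra.ι (quadForm R) (Finsupp.single k 1, 0)

/-- The creation operator `ψ*` at position `k - 1/2`, as an element of `A`. -/
def psiStar (k : ℤ) : Alg R := CliffordAlgebra.ι (quadForm R) (0, Finsupp.single k 1)

theorem pairing_single (c : ℤ → R) (i : ℤ) (r : R) (b : ℤ →₀ R) :
    pairing c (Finsupp.single i r) b = r * (c i * b i) := by
  simp [pairing]

theorem quadForm_apply (w : FreeFermions R) :
    quadForm R w = pairing (fun _ => (1 : R)) w.1 w.2 := rfl

theorem psi_mul_psi (i j : ℤ) : psi i * psi j + psi j * psi i = (0 : Alg R) := by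
  rw [psi, psi, CliffordAlgebra.ι_mul_ι_add_swap]
  simp only [QuadraticMap.polar, quadForm_apply, Prod.snd_add, add_zero, map_zero, sub_zero]

theorem psiStar_mul_psiStar (i j : ℤ) :
    psiStar i * psiStar j + psiStar j * psiStar i = (0 : Alg R) := by
  rw [psiStar, psiStar, CliffordAlgebra.ι_mul_ι_add_swap]
  simp only [QuadraticMap.polar, quadForm_apply, Prod.fst_add, add_zero, map_zero,
    LinearMap.zero_apply, sub_zero]

theorem psi_mul_psiStar (i j : ℤ) :
    psi i * psiStar j + psiStar j * psi i = (if i = j then 1 else 0 : Alg R) := by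
  rw [psi, psiStar, CliffordAlgebra.ι_mul_ι_add_swap]
  simp only [QuadraticMap.polar, quadForm_apply, Prod.fst_add, Prod.snd_add, add_zero, zero_add,
    pairing_single, map_zero, sub_zero, Finsupp.single_apply, LinearMap.zero_apply, one_mul]
  by_cases h : i = j
  · rw [if_pos h.symm, if_pos h, map_one]
  · rw [if_neg (Ne.symm h), if_neg h, map_zero]

/-! ### The Fock space and the vacuum expectation value -/

variable (R)

/-- The left ideal `A 𝒲_ann`, where `𝒲_ann` is spanned by the `ψ*` at negative positions and the
`ψ` at positive positions. -/
def annIdeal : Ideal (Alg R) :=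
  Ideal.span ({a | ∃ k : ℤ, k ≤ 0 ∧ a = psiStar k} ∪ {a | ∃ k : ℤ, 1 ≤ k ∧ a = psi k})

/-- The Fock space `ℱ = A / A 𝒲_ann`, a left `A`-module. -/
def Fock : Type _ := Alg R ⧸ annIdeal R

instance : AddCommGroup (Fock R) := inferInstanceAs (AddCommGroup (Alg R ⧸ annIdeal R))

instance : Module (Alg R) (Fock R) := inferInstanceAs (Module (Alg R) (Alg R ⧸ annIdeal R))

instance : Module R (Fock R) := Submodule.Quotient.module' (annIdeal R)

instance : IsScalarTower R (Alg R) (Fock R) :=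
  inferInstanceAs (IsScalarTower R (Alg R) (Alg R ⧸ annIdeal R))

instance : SMulCommClass R (Alg R) (Fock R) := IsScalarTower.to_smulCommClass

variable {R}

/-- The vector `a |0⟩` of the Fock space. -/
def ket (a : Alg R) : Fock R := Submodule.Quotient.mk a

variable (R)

/-- The bilinear form on `𝒲` with `(ψ_k, ψ*_k) ↦ 1` for positive positions, `(ψ*_k, ψ_k) ↦ 1` for
negative positions, and all other pairs of generators sent to `0`. -/
def contraction : LinearMap.BilinForm R (FreeFermions R) :=
  (pairing (fun k => if 1 ≤ k then (1 : R) else 0)).compl₁₂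
      (LinearMap.fst R _ _) (LinearMap.snd R _ _) +
    (pairing (fun k => if 1 ≤ k then (0 : R) else 1)).compl₁₂
      (LinearMap.snd R _ _) (LinearMap.fst R _ _)

theorem pairing_add (c d : ℤ → R) (a b : ℤ →₀ R) :
    pairing c a b + pairing d a b = pairing (c + d) a b := by
  induction a using Finsupp.induction_linear with
  | zero => simp
  | add f g hf hg =>
    simp only [map_add, LinearMap.add_apply, ← hf, ← hg]
    abel
  | single i r => simp only [pairing_single, Pi.add_apply]; ring

theorem pairing_comm (c : ℤ → R) (a b : ℤ →₀ R) : pairing c a b = pairing c b a := by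
  induction a using Finsupp.induction_linear with
  | zero => simp
  | add f g hf hg => simp only [map_add, LinearMap.add_apply, hf, hg]
  | single i r =>
    induction b using Finsupp.induction_linear with
    | zero => simp
    | add f g hf hg => simp only [map_add, LinearMap.add_apply, hf, hg]
    | single j s =>
      simp only [pairing_single, Finsupp.single_apply]
      by_cases h : i = j
      · subst h; simp; ring
      · simp [h, Ne.symm h]

theorem contraction_toQuadraticMap :
    (-contraction R).toQuadraticMap = (0 : QuadraticForm R (FreeFermions R)) - quadForm R := by
  ext ⟨a, b⟩
  simp only [contraction, quadForm, LinearMap.BilinMap.toQuadraticMap_apply, LinearMap.neg_apply,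
    LinearMap.add_apply, LinearMap.compl₁₂_apply, LinearMap.fst_apply, LinearMap.snd_apply,
    sub_apply, zero_apply, zero_sub, neg_inj]
  rw [pairing_comm R _ b a, pairing_add]
  congr 2
  congr 1
  funext k
  by_cases h : 1 ≤ k <;> simp [h]

/-- The vacuum expectation value `a ↦ ⟨0| a |0⟩`: the scalar term of the normally ordered form of
`a`, an element of the exterior algebra of `𝒲`. By `vev_one`, `vev_cr_mul` and `vev_mul_ann`
below it takes the value `1` at `1` and vanishes on `𝒲_cr A + A 𝒲_ann`; as
`A = R ⊕ (𝒲_cr A + A 𝒲_ann)`, it is the only linear form that does. -/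
def vev : Alg R →ₗ[R] R :=
  (ExteriorAlgebra.algebraMapInv (R := R) (M := FreeFermions R)).toLinearMap ∘ₗ
    CliffordAlgebra.changeForm (contraction_toQuadraticMap R)

variable {R}

theorem vev_one : vev R 1 = 1 := by
  simp [vev]

theorem contraction_eq_zero_left {w : FreeFermions R}
    (hw : (∃ k : ℤ, 1 ≤ k ∧ w = (0, Finsupp.single k 1)) ∨
      ∃ k : ℤ, k ≤ 0 ∧ w = (Finsupp.single k 1, 0)) : contraction R w = 0 := by
  refine LinearMap.ext fun v => ?_
  rcases hw with ⟨k, hk, rfl⟩ | ⟨k, hk, rfl⟩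
  · simp [contraction, pairing_single, hk]
  · simp [contraction, pairing_single, show ¬ 1 ≤ k by omega]

theorem contraction_eq_zero_right {w : FreeFermions R}
    (hw : (∃ k : ℤ, k ≤ 0 ∧ w = (0, Finsupp.single k 1)) ∨
      ∃ k : ℤ, 1 ≤ k ∧ w = (Finsupp.single k 1, 0)) (v : FreeFermions R) :
    contraction R v w = 0 := by
  rcases hw with ⟨k, hk, rfl⟩ | ⟨k, hk, rfl⟩
  · simp [contraction, pairing_comm R _ _ (Finsupp.single k 1), pairing_single,
      show ¬ 1 ≤ k by omega]
  · simp [contraction, pairing_comm R _ _ (Finsupp.single k 1), pairing_single, hk]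

theorem vev_ι_mul {w : FreeFermions R} (hw : contraction R w = 0) (x : Alg R) :
    vev R (CliffordAlgebra.ι (quadForm R) w * x) = 0 := by
  simp only [vev, LinearMap.comp_apply, CliffordAlgebra.changeForm_ι_mul, LinearMap.neg_apply, hw,
    neg_zero, map_zero, LinearMap.zero_apply, sub_zero, AlgHom.toLinearMap_apply, map_mul]
  rw [show CliffordAlgebra.ι (0 : QuadraticForm R (FreeFermions R)) w = ExteriorAlgebra.ι R w
    from rfl]
  simp [ExteriorAlgebra.algebraMapInv]

theorem contractLeft_mul_ι {d : Module.Dual R (FreeFermions R)} {w : FreeFermions R}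
    (hd : d w = 0) (y : ExteriorAlgebra R (FreeFermions R)) :
    CliffordAlgebra.contractLeft (Q := 0) d (y * CliffordAlgebra.ι 0 w) =
      CliffordAlgebra.contractLeft (Q := 0) d y * CliffordAlgebra.ι 0 w := by
  induction y using CliffordAlgebra.left_induction with
  | algebraMap r => simp [CliffordAlgebra.contractLeft_algebraMap_mul, hd]
  | add a b ha hb => rw [add_mul, map_add, ha, hb, map_add, add_mul]
  | ι_mul m x h =>
    rw [mul_assoc, CliffordAlgebra.contractLeft_ι_mul, h, CliffordAlgebra.contractLeft_ι_mul,
      sub_mul, smul_mul_assoc, mul_assoc]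

theorem vev_mul_ι {w : FreeFermions R} (hw : ∀ v, contraction R v w = 0) (x : Alg R) :
    vev R (x * CliffordAlgebra.ι (quadForm R) w) = 0 := by
  have key : CliffordAlgebra.changeForm (contraction_toQuadraticMap R)
      (x * CliffordAlgebra.ι (quadForm R) w) =
      CliffordAlgebra.changeForm (contraction_toQuadraticMap R) x * CliffordAlgebra.ι 0 w := by
    induction x using CliffordAlgebra.left_induction with
    | algebraMap r =>
      rw [← Algebra.smul_def, map_smul, CliffordAlgebra.changeForm_ι,
        CliffordAlgebra.changeForm_algebraMap, Algebra.smul_def]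
    | add a b ha hb => rw [add_mul, map_add, ha, hb, map_add, add_mul]
    | ι_mul x m h =>
      have hd : (-contraction R) m w = 0 := by simp [hw]
      rw [mul_assoc, CliffordAlgebra.changeForm_ι_mul, h, CliffordAlgebra.changeForm_ι_mul,
        contractLeft_mul_ι hd, sub_mul, mul_assoc]
  simp only [vev, LinearMap.comp_apply, key, AlgHom.toLinearMap_apply, map_mul]
  rw [show CliffordAlgebra.ι (0 : QuadraticForm R (FreeFermions R)) w = ExteriorAlgebra.ι R w
    from rfl]
  simp [ExteriorAlgebra.algebraMapInv]

/-- `⟨0|` kills `𝒲_cr A`. -/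
theorem vev_cr_mul (k : ℤ) (x : Alg R) :
    (1 ≤ k → vev R (psiStar k * x) = 0) ∧ (k ≤ 0 → vev R (psi k * x) = 0) :=
  ⟨fun h => vev_ι_mul (contraction_eq_zero_left (Or.inl ⟨k, h, rfl⟩)) x,
    fun h => vev_ι_mul (contraction_eq_zero_left (Or.inr ⟨k, h, rfl⟩)) x⟩

/-- `|0⟩` is killed by `A 𝒲_ann`. -/
theorem vev_mul_ann (k : ℤ) (x : Alg R) :
    (k ≤ 0 → vev R (x * psiStar k) = 0) ∧ (1 ≤ k → vev R (x * psi k) = 0) :=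
  ⟨fun h => vev_mul_ι (contraction_eq_zero_right (Or.inl ⟨k, h, rfl⟩)) x,
    fun h => vev_mul_ι (contraction_eq_zero_right (Or.inr ⟨k, h, rfl⟩)) x⟩

theorem vev_eq_zero_of_mem {x : Alg R} (hx : x ∈ annIdeal R) : vev R x = 0 := by
  suffices h : ∀ a : Alg R, vev R (a * x) = 0 by simpa using h 1
  refine Submodule.span_induction ?_ ?_ ?_ ?_ hx
  · rintro _ (⟨k, hk, rfl⟩ | ⟨k, hk, rfl⟩) a
    · exact (vev_mul_ann k a).1 hk
    · exact (vev_mul_ann k a).2 hk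
  · simp
  · intro y z _ _ hy hz a
    rw [mul_add, map_add, hy, hz, add_zero]
  · intro b y _ hy a
    rw [smul_eq_mul, ← mul_assoc, hy]

/-- The bra `⟨0| a`, as a linear form on the Fock space: `⟨0| a · b |0⟩ = vev (a * b)`. -/
def bra (a : Alg R) : Fock R →ₗ[R] R :=
  ((annIdeal R).restrictScalars R).liftQ (vev R ∘ₗ LinearMap.mulLeft R a)
    (fun _ hx => vev_eq_zero_of_mem ((annIdeal R).mul_mem_left a hx))

theorem bra_ket (a b : Alg R) : bra a (ket b) = vev R (a * b) := rfl

/-! ### The operators `J_n`, the Hamiltonian and its exponential -/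

/-- The normally ordered product `:ψ*_i ψ_j:`. -/
def normalOrdered (i j : ℤ) : Alg R :=
  if 1 ≤ i then psiStar i * psi j else -(psi j * psiStar i)

/-- The vectors killed by the `ψ*_k` with `k < a` and by the `ψ_k` with `b < k`. -/
def IsBounded (a b : ℤ) (v : Fock R) : Prop :=
  (∀ k < a, (psiStar k : Alg R) • v = 0) ∧ ∀ k > b, (psi k : Alg R) • v = 0

theorem IsBounded.mono {a b a' b' : ℤ} {v : Fock R} (h : IsBounded a b v) (ha : a' ≤ a)
    (hb : b ≤ b') : IsBounded a' b' v :=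
  ⟨fun k hk => h.1 k (hk.trans_le ha), fun k hk => h.2 k (lt_of_le_of_lt hb hk)⟩

theorem IsBounded.add {a b : ℤ} {v w : Fock R} (hv : IsBounded a b v) (hw : IsBounded a b w) :
    IsBounded a b (v + w) :=
  ⟨fun k hk => by rw [smul_add, hv.1 k hk, hw.1 k hk, add_zero],
    fun k hk => by rw [smul_add, hv.2 k hk, hw.2 k hk, add_zero]⟩

theorem IsBounded.smul {a b : ℤ} {v : Fock R} (hv : IsBounded a b v) (r : R) :
    IsBounded a b (r • v) :=
  ⟨fun k hk => by rw [smul_comm, hv.1 k hk, smul_zero],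
    fun k hk => by rw [smul_comm, hv.2 k hk, smul_zero]⟩

theorem isBounded_zero (a b : ℤ) : IsBounded a b (0 : Fock R) :=
  ⟨fun _ _ => smul_zero _, fun _ _ => smul_zero _⟩

theorem psi_smul_psi_smul (i j : ℤ) (v : Fock R) :
    (psi i : Alg R) • (psi j : Alg R) • v = -((psi j : Alg R) • (psi i : Alg R) • v) := by
  rw [smul_smul, smul_smul, eq_neg_iff_add_eq_zero, ← add_smul, psi_mul_psi, zero_smul]

theorem psiStar_smul_psiStar_smul (i j : ℤ) (v : Fock R) :
    (psiStar i : Alg R) • (psiStar j : Alg R) • v =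
      -((psiStar j : Alg R) • (psiStar i : Alg R) • v) := by
  rw [smul_smul, smul_smul, eq_neg_iff_add_eq_zero, ← add_smul, psiStar_mul_psiStar, zero_smul]

theorem psi_smul_psiStar_smul (i j : ℤ) (v : Fock R) :
    (psi i : Alg R) • (psiStar j : Alg R) • v =
      (if i = j then v else 0) - (psiStar j : Alg R) • (psi i : Alg R) • v := by
  rw [smul_smul, smul_smul, eq_sub_iff_add_eq, ← add_smul, psi_mul_psiStar]
  split_ifs <;> simp

theorem IsBounded.psi_smul {a b : ℤ} {v : Fock R} (hv : IsBounded a b v) (j : ℤ) :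
    IsBounded (min a j) b ((psi j : Alg R) • v) := by
  refine ⟨fun k hk => ?_, fun k hk => ?_⟩
  · have h := psi_smul_psiStar_smul j k v
    rw [hv.1 k (by omega), smul_zero, if_neg (by omega), zero_sub, zero_eq_neg] at h
    exact h
  · rw [psi_smul_psi_smul, hv.2 k hk, smul_zero, neg_zero]

theorem IsBounded.psiStar_smul {a b : ℤ} {v : Fock R} (hv : IsBounded a b v) (j : ℤ) :
    IsBounded a (max b j) ((psiStar j : Alg R) • v) := by
  refine ⟨fun k hk => ?_, fun k hk => ?_⟩
  · rw [psiStar_smul_psiStar_smul, hv.1 k hk, smul_zero, neg_zero]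
  · rw [psi_smul_psiStar_smul, hv.2 k (by omega), smul_zero, if_neg (by omega), sub_zero]

theorem ι_eq_sum (w : FreeFermions R) :
    CliffordAlgebra.ι (quadForm R) w =
      (w.1.sum fun k r => r • psi k) + w.2.sum fun k r => r • psiStar k := by
  obtain ⟨f, g⟩ := w
  have hf : ∀ f : ℤ →₀ R, CliffordAlgebra.ι (quadForm R) (f, 0) = f.sum fun k r => r • psi k := by
    intro f
    induction f using Finsupp.induction_linear with
    | zero => rw [Finsupp.sum_zero_index]; exact map_zero _
    | add f g hf hg =>
      rw [Finsupp.sum_add_index' (by simp) (by intros; rw [add_smul]), ← hf, ← hg, ← map_add]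
      simp
    | single k r => rw [Finsupp.sum_single_index (by simp), psi, ← map_smul]; simp
  have hg : ∀ f : ℤ →₀ R,
      CliffordAlgebra.ι (quadForm R) (0, f) = f.sum fun k r => r • psiStar k := by
    intro f
    induction f using Finsupp.induction_linear with
    | zero => rw [Finsupp.sum_zero_index]; exact map_zero _
    | add f g hf hg =>
      rw [Finsupp.sum_add_index' (by simp) (by intros; rw [add_smul]), ← hf, ← hg, ← map_add]
      simp
    | single k r => rw [Finsupp.sum_single_index (by simp), psiStar, ← map_smul]; simp
  rw [← hf, ← hg, ← map_add]
  simp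

theorem exists_add {v w : Fock R} (hv : ∃ a b, IsBounded a b v) (hw : ∃ a b, IsBounded a b w) :
    ∃ a b, IsBounded a b (v + w) := by
  obtain ⟨a, b, h⟩ := hv
  obtain ⟨a', b', h'⟩ := hw
  exact ⟨min a a', max b b', (h.mono (min_le_left _ _) (le_max_left _ _)).add
    (h'.mono (min_le_right _ _) (le_max_right _ _))⟩

theorem exists_sum {f : ℤ →₀ R} {g : ℤ → Alg R} {v : Fock R}
    (h : ∀ k, ∃ a b, IsBounded a b (g k • v)) :
    ∃ a b, IsBounded a b ((f.sum fun k r => r • g k) • v) := by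
  induction f using Finsupp.induction_linear with
  | zero => exact ⟨0, 0, by simpa using isBounded_zero 0 0⟩
  | add f g hf hg =>
    rw [Finsupp.sum_add_index' (by simp) (by intros; rw [add_smul]), add_smul]
    exact exists_add hf hg
  | single k r =>
    obtain ⟨a, b, hab⟩ := h k
    exact ⟨a, b, by simpa [smul_assoc] using hab.smul r⟩

theorem exists_isBounded (v : Fock R) : ∃ a b, IsBounded a b v := by
  obtain ⟨x, rfl⟩ := Submodule.Quotient.mk_surjective _ v
  induction x using CliffordAlgebra.left_induction with
  | algebraMap r =>
    refine ⟨1, 0, ?_⟩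
    have h1 : IsBounded 1 0 (ket (1 : Alg R)) := by
      refine ⟨fun k hk => ?_, fun k hk => ?_⟩
      · refine (Submodule.Quotient.mk_eq_zero (annIdeal R)).2 ?_
        change _ * 1 ∈ _
        rw [mul_one]
        exact Ideal.subset_span (Or.inl ⟨k, by omega, rfl⟩)
      · refine (Submodule.Quotient.mk_eq_zero (annIdeal R)).2 ?_
        change _ * 1 ∈ _
        rw [mul_one]
        exact Ideal.subset_span (Or.inr ⟨k, by omega, rfl⟩)
    rw [Algebra.algebraMap_eq_smul_one]
    exact h1.smul r
  | add x y hx hy => exact exists_add hx hy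
  | ι_mul x w hx =>
    obtain ⟨a, b, h⟩ := hx
    rw [← smul_eq_mul, Submodule.Quotient.mk_smul, ι_eq_sum, add_smul]
    exact exists_add (exists_sum fun k => ⟨_, _, h.psi_smul k⟩)
      (exists_sum fun k => ⟨_, _, h.psiStar_smul k⟩)

theorem finite_support_J (n : ℤ) (v : Fock R) :
    (Function.support fun i : ℤ => (normalOrdered (i - n) i : Alg R) • v).Finite := by
  obtain ⟨a, b, h⟩ := exists_isBounded v
  refine (Set.finite_Icc (min (a + n) (n + 1)) (max b n)).subset fun i hi => ?_
  by_contra hc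
  refine hi ?_
  simp only [normalOrdered]
  rw [Set.mem_Icc, not_and_or] at hc
  split_ifs with h1
  · rw [mul_smul, h.2 i (by omega), smul_zero]
  · rw [neg_smul, mul_smul, h.1 (i - n) (by omega), smul_zero, neg_zero]

/-- The operator `J_n = ∑ i, :ψ*_{i-n} ψ_i:` on the Fock space; by `finite_support_J` only finitely
many terms act nontrivially on a given vector. -/
def J (n : ℤ) : Fock R →ₗ[R] Fock R where
  toFun v := ∑ᶠ i : ℤ, (normalOrdered (i - n) i : Alg R) • v
  map_add' v w := by
    simp only [smul_add]
    exact finsum_add_distrib (finite_support_J n v) (finite_support_J n w)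
  map_smul' r v := by
    simp only [smul_comm _ r, RingHom.id_apply]
    exact (smul_finsum' r (finite_support_J n v)).symm

theorem normalOrdered_smul_of_ne {i j : ℤ} (h : i ≠ j) (v : Fock R) :
    (normalOrdered i j : Alg R) • v = (psiStar i : Alg R) • (psi j : Alg R) • v := by
  rw [normalOrdered]
  split_ifs with h1
  · rw [mul_smul]
  · rw [neg_smul, mul_smul, psi_smul_psiStar_smul, if_neg h.symm, zero_sub, neg_neg]

theorem normalOrdered_smul_eq_zero {a b i : ℤ} {q : ℕ} {v : Fock R} (h : IsBounded a b v)
    (hc : i - (q + 1 : ℤ) < a ∨ b < i) :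
    (normalOrdered (i - (q + 1 : ℤ)) i : Alg R) • v = 0 := by
  rcases hc with hc | hc
  · have h2 := psi_smul_psiStar_smul i (i - (q + 1 : ℤ)) v
    rw [h.1 _ hc, smul_zero, if_neg (by omega), zero_sub, zero_eq_neg] at h2
    rw [normalOrdered_smul_of_ne (by omega), h2]
  · rw [normalOrdered_smul_of_ne (by omega), h.2 _ hc, smul_zero]

theorem J_eq_zero {a b : ℤ} {q : ℕ} {v : Fock R} (h : IsBounded a b v)
    (hq : b - a < (q + 1 : ℤ)) : J (q + 1 : ℤ) v = 0 := by
  change ∑ᶠ i : ℤ, (normalOrdered (i - (q + 1 : ℤ)) i : Alg R) • v = 0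
  rw [← finsum_zero (α := ℤ)]
  refine finsum_congr fun i => normalOrdered_smul_eq_zero h ?_
  omega

theorem finite_support_H (t : ℕ → R) (v : Fock R) :
    (Function.support fun q : ℕ => t (q + 1) • J (q + 1 : ℤ) v).Finite := by
  obtain ⟨a, b, h⟩ := exists_isBounded v
  refine (Set.finite_Iic (b - a).toNat).subset fun q hq => ?_
  by_contra hc
  rw [Set.mem_Iic] at hc
  exact hq (by simp only [J_eq_zero h (q := q) (by omega), smul_zero])

/-- The Hamiltonian `H[t] = ∑_{q ≥ 1} t_q J_q` (the value `t 0` is not used); by `finite_support_H`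
only finitely many terms act nontrivially on a given vector. -/
def H (t : ℕ → R) : Fock R →ₗ[R] Fock R where
  toFun v := ∑ᶠ q : ℕ, t (q + 1) • J (q + 1 : ℤ) v
  map_add' v w := by
    simp only [map_add, smul_add]
    exact finsum_add_distrib (finite_support_H t v) (finite_support_H t w)
  map_smul' r v := by
    simp only [map_smul, smul_comm _ r, RingHom.id_apply]
    exact (smul_finsum' r (finite_support_H t v)).symm

theorem H_induction (t : ℕ → R) (p : Fock R → Prop) (h0 : p 0) (hadd : ∀ v w, p v → p w → p (v + w))
    (hsmul : ∀ (r : R) v, p v → p (r • v)) (v : Fock R)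
    (hv : ∀ (q : ℕ) (i : ℤ), p ((psiStar (i - (q + 1 : ℤ)) : Alg R) • (psi i : Alg R) • v)) :
    p (H t v) := by
  refine finsum_induction p h0 hadd fun q => hsmul _ _ ?_
  refine finsum_induction p h0 hadd fun i => ?_
  rw [normalOrdered_smul_of_ne (by omega)]
  exact hv q i

theorem psi_smul_J {a b : ℤ} {v : Fock R} (h : IsBounded a b v) {k : ℤ} (hk : b ≤ k) (q : ℕ) :
    (psi k : Alg R) • J (q + 1 : ℤ) v = J (q + 1 : ℤ) ((psi k : Alg R) • v) := by
  change (psi k : Alg R) • (∑ᶠ i : ℤ, (normalOrdered (i - (q + 1 : ℤ)) i : Alg R) • v) =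
    ∑ᶠ i : ℤ, (normalOrdered (i - (q + 1 : ℤ)) i : Alg R) • (psi k : Alg R) • v
  rw [smul_finsum' _ (finite_support_J _ v)]
  refine finsum_congr fun i => ?_
  rw [normalOrdered_smul_of_ne (by omega), normalOrdered_smul_of_ne (by omega),
    psi_smul_psiStar_smul, psi_smul_psi_smul k i, smul_neg]
  split_ifs with hki
  · rw [h.2 i (by omega)]; simp
  · simp

theorem psi_smul_H {a b : ℤ} {v : Fock R} (h : IsBounded a b v) (t : ℕ → R) {k : ℤ} (hk : b ≤ k) :
    (psi k : Alg R) • H t v = H t ((psi k : Alg R) • v) := by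
  change (psi k : Alg R) • (∑ᶠ q : ℕ, t (q + 1) • J (q + 1 : ℤ) v) =
    ∑ᶠ q : ℕ, t (q + 1) • J (q + 1 : ℤ) ((psi k : Alg R) • v)
  rw [smul_finsum' _ (finite_support_H t v)]
  refine finsum_congr fun q => ?_
  rw [smul_comm, psi_smul_J h hk]

theorem IsBounded.psiStar_psi {a b : ℤ} {v : Fock R} (h : IsBounded a b v) (q : ℕ) (i : ℤ)
    (k : ℤ) (hk : k < a) :
    (psiStar k : Alg R) • (psiStar (i - (q + 1 : ℤ)) : Alg R) • (psi i : Alg R) • v = 0 := by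
  rw [psiStar_smul_psiStar_smul]
  by_cases hki : i = k
  · have h2 := h.1 (i - (q + 1 : ℤ)) (by omega)
    have h3 := psi_smul_psiStar_smul i (i - (q + 1 : ℤ)) v
    rw [h2, smul_zero, if_neg (by omega), zero_sub, zero_eq_neg] at h3
    rw [← psiStar_smul_psiStar_smul, h3, smul_zero]
  · have h3 := psi_smul_psiStar_smul i k v
    rw [h.1 k hk, smul_zero, if_neg hki, zero_sub, zero_eq_neg] at h3
    rw [h3, smul_zero, neg_zero]

theorem IsBounded.H {a b : ℤ} {v : Fock R} (h : IsBounded a b v) (t : ℕ → R) :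
    IsBounded a b (H t v) := by
  refine ⟨fun k hk => ?_, fun k hk => ?_⟩
  · refine H_induction t (fun w => (psiStar k : Alg R) • w = 0) (smul_zero _) ?_ ?_ v
      fun q i => h.psiStar_psi q i k hk
    · intro v w hv hw
      rw [smul_add, hv, hw, add_zero]
    · intro r v hv
      rw [smul_comm, hv, smul_zero]
  · rw [psi_smul_H h t hk.le, h.2 k hk, map_zero]

theorem IsBounded.H_pow {a b : ℤ} {v : Fock R} (h : IsBounded a b v) (t : ℕ → R) (m : ℕ) :
    IsBounded a b ((Fermion.H t ^ m) v) := by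
  induction m with
  | zero => simpa using h
  | succ m ih => rw [pow_succ']; exact ih.H t

theorem psi_smul_H_pow {a b : ℤ} {v : Fock R} (h : IsBounded a b v) (t : ℕ → R) (m : ℕ) :
    (psi b : Alg R) • (H t ^ m) v = (H t ^ m) ((psi b : Alg R) • v) := by
  induction m with
  | zero => simp
  | succ m ih =>
    rw [pow_succ', Module.End.mul_apply, Module.End.mul_apply,
      psi_smul_H (h.H_pow t m) t le_rfl, ih]

theorem exists_H_pow_eq_zero (t : ℕ → R) (a : ℤ) (d : ℕ) :
    ∃ N : ℕ, ∀ v : Fock R, IsBounded a (a - 1 + d) v → (H t ^ N) v = 0 := by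
  induction d with
  | zero =>
    refine ⟨1, fun v hv => ?_⟩
    rw [pow_one]
    change ∑ᶠ q : ℕ, t (q + 1) • J (q + 1 : ℤ) v = 0
    rw [← finsum_zero (α := ℕ)]
    refine finsum_congr fun q => ?_
    rw [J_eq_zero hv (by push_cast; omega), smul_zero]
  | succ d ih =>
    obtain ⟨N, hN⟩ := ih
    refine ⟨N + N, fun v hv => ?_⟩
    rw [pow_add, Module.End.mul_apply]
    refine hN _ ⟨(hv.H_pow t N).1, fun k hk => ?_⟩
    by_cases hkb : k = a - 1 + (d + 1 : ℕ)
    · rw [hkb, psi_smul_H_pow hv]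
      refine hN _ ⟨((hv.psi_smul _).mono (by push_cast; omega) le_rfl).1, fun l hl => ?_⟩
      by_cases hl' : l = a - 1 + (d + 1 : ℕ)
      · rw [hl', smul_smul, psi, CliffordAlgebra.ι_sq_scalar]
        simp only [quadForm_apply, map_zero, zero_smul]
      · exact (hv.psi_smul _).2 l (by push_cast at *; omega)
    · exact (hv.H_pow t N).2 k (by push_cast at *; omega)

theorem finite_support_expH [Algebra ℚ R] (t : ℕ → R) (v : Fock R) :
    (Function.support fun k : ℕ =>
      algebraMap ℚ R (1 / (k.factorial : ℚ)) • (H t ^ k) v).Finite := by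
  obtain ⟨a, b, h⟩ := exists_isBounded v
  obtain ⟨N, hN⟩ := exists_H_pow_eq_zero t a (b - a + 1).toNat
  have h0 : (H t ^ N) v = 0 := hN v (h.mono le_rfl (by omega))
  refine (Set.finite_Iio N).subset fun k hk => ?_
  by_contra hc
  refine hk ?_
  rw [Set.mem_Iio, not_lt] at hc
  obtain ⟨m, rfl⟩ := Nat.exists_eq_add_of_le' hc
  simp only [pow_add, Module.End.mul_apply, h0, map_zero, smul_zero]

/-- The operator `e^{H[t]} = ∑_{k ≥ 0} H[t]^k / k!` on the Fock space; by `finite_support_expH` only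
finitely many terms act nontrivially on a given vector. -/
def expH [Algebra ℚ R] (t : ℕ → R) : Fock R →ₗ[R] Fock R where
  toFun v := ∑ᶠ k : ℕ, algebraMap ℚ R (1 / (k.factorial : ℚ)) • (H t ^ k) v
  map_add' v w := by
    simp only [map_add, smul_add]
    exact finsum_add_distrib (finite_support_expH t v) (finite_support_expH t w)
  map_smul' r v := by
    simp only [map_smul, smul_comm _ r, RingHom.id_apply]
    exact (smul_finsum' r (finite_support_expH t v)).symm

/-! ### The states `|λ;ℓ⟩` and `⟨μ;ℓ|` -/

/-- The element `a` of `A` with `|ℓ⟩ = a |0⟩`: it is `ψ_{ℓ+1/2} ⋯ ψ_{-1/2}` for `ℓ < 0`, it is `1`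
for `ℓ = 0` and `ψ*_{ℓ-1/2} ⋯ ψ*_{1/2}` for `ℓ > 0` (positions are half-integers here). -/
def shiftOp (l : ℤ) : Alg R :=
  if l < 0 then (List.ofFn fun i : Fin (-l).toNat => (psi (l + 1 + (i : ℤ)) : Alg R)).prod
  else (List.ofFn fun i : Fin l.toNat => (psiStar (l - (i : ℤ)) : Alg R)).prod

/-- The element `a` of `A` with `⟨ℓ| = ⟨0| a`: it is `ψ*_{-1/2} ⋯ ψ*_{ℓ+1/2}` for `ℓ < 0`, it is
`1` for `ℓ = 0` and `ψ_{1/2} ⋯ ψ_{ℓ-1/2}` for `ℓ > 0` (positions are half-integers here). -/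
def coshiftOp (l : ℤ) : Alg R :=
  if l < 0 then (List.ofFn fun i : Fin (-l).toNat => (psiStar (-(i : ℤ)) : Alg R)).prod
  else (List.ofFn fun i : Fin l.toNat => (psi (1 + (i : ℤ)) : Alg R)).prod

/-- `|λ;ℓ⟩ = ψ*_{ℓ+λ₁-1/2} ψ*_{ℓ+λ₂-3/2} ⋯ ψ*_{ℓ+λ_n-n+1/2} |ℓ-n⟩` (positions are half-integers
here; `lam i` is the part `λ_{i+1}`, its position has index `ℓ + lam i - i`). -/
def partitionKet {n : ℕ} (lam : Fin n → ℕ) (l : ℤ) : Fock R :=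
  ket ((List.ofFn fun i : Fin n => (psiStar (l + lam i - (i : ℤ)) : Alg R)).prod *
    shiftOp (l - n))

/-- `⟨μ;ℓ| = ⟨ℓ-n| ψ_{ℓ+μ_n-n+1/2} ⋯ ψ_{ℓ+μ₂-3/2} ψ_{ℓ+μ₁-1/2}` (positions are half-integers
here). -/
def partitionBra {n : ℕ} (mu : Fin n → ℕ) (l : ℤ) : Fock R →ₗ[R] R :=
  bra (coshiftOp (l - n) *
    (List.ofFn fun i : Fin n => (psi (l + mu i - (i : ℤ)) : Alg R)).reverse.prod)

/-! ### The parameters -/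

/-- `s_q = (x^q - (-y)^q) / q`. -/
def superTime [Algebra ℚ R] (x y : R) (q : ℕ) : R :=
  algebraMap ℚ R (1 / (q : ℚ)) * (x ^ q - (-y) ^ q)

/-- `s_q^+(t) = (1/q) ∑_j (1 - (-t_j)^q) x_j^q`. -/
def sPlus [Algebra ℚ R] {N : ℕ} (x t : Fin N → R) (q : ℕ) : R :=
  algebraMap ℚ R (1 / (q : ℚ)) * ∑ j, (1 - (-t j) ^ q) * x j ^ q

end Fermion

/-! ### Supersymmetric skew Schur functions -/

namespace SuperSchur

variable {R : Type*} [CommRing R]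

/-- `h_k[x | y] = ∑_{i=0}^k h_i[x] e_{k-i}[y]`, and `0` for `k < 0`. -/
def superH {a b : ℕ} (x : Fin a → R) (y : Fin b → R) (k : ℤ) : R :=
  if k < 0 then 0
  else ∑ i ∈ Finset.range (k.toNat + 1),
    MvPolynomial.aeval x (MvPolynomial.hsymm (Fin a) ℤ i) *
      MvPolynomial.aeval y (MvPolynomial.esymm (Fin b) ℤ (k.toNat - i))

/-- The cells of the skew diagram `λ/μ`: row `i` consists of the columns `μ_i ≤ j < λ_i`. -/
def skewCells {n : ℕ} (lam mu : Fin n → ℕ) : Finset (Fin n × ℕ) :=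
  Finset.univ.biUnion fun i => (Finset.Ico (mu i) (lam i)).image fun j => (i, j)

/-- A supertableau with letters `1 < ⋯ < a < 1' < ⋯ < b'`: rows and columns weakly increase, an
unprimed letter occurs at most once in each column, a primed letter at most once in each row. -/
def IsSupertableau {n a b : ℕ} {D : Finset (Fin n × ℕ)} (T : D → Fin a ⊕ₗ Fin b) : Prop :=
  (∀ c d : D, c.1.1 = d.1.1 → c.1.2 < d.1.2 →
    T c ≤ T d ∧ ∀ j : Fin b, ¬(T c = Sum.inrₗ j ∧ T d = Sum.inrₗ j)) ∧
  ∀ c d : D, c.1.2 = d.1.2 → c.1.1 < d.1.1 →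
    T c ≤ T d ∧ ∀ i : Fin a, ¬(T c = Sum.inlₗ i ∧ T d = Sum.inlₗ i)

open Classical in
/-- The supersymmetric skew Schur function `s_{λ/μ}(x | y)`: the sum of the weights of all
supertableaux of shape `λ/μ`, where the letter `i` has weight `x_i` and the letter `j'` weight
`y_j`; it is `0` unless `μ ⊆ λ`. -/
def superSchur {n a b : ℕ} (lam mu : Fin n → ℕ) (x : Fin a → R) (y : Fin b → R) : R :=
  if ∀ i, mu i ≤ lam i then
    ∑ T : skewCells lam mu → Fin a ⊕ₗ Fin b with IsSupertableau T,
      ∏ c, Sum.elim x y (ofLex (T c))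
  else 0

end SuperSchur

end

/-! ### The Jacobi–Trudi determinant in one variable of each kind as a product over rows. -/

namespace SuperSchur

open Finset

variable {R : Type*} [CommRing R]

/-! Both the matrix element and the Schur function are evaluated as the same determinant in the
$h_k(x\mid y)$.

Fermionic side. Since $[J_q,\psi^*_k]=\psi^*_{k-q}$, moving $e^{H[s]}$ past $\psi^*_k$ replaces it
by $\sum_j c_j\psi^*_{k-j}$, where $\sum_j c_jz^j=\exp(\sum_q s_qz^q)$ (`expH_psiStar_smul`). For
the given $s_q$ this series is $(1+yz)/(1-xz)=\sum_j h_j(x\mid y)z^j$ (`exp_subst_superTime`).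
Moving $\psi_{-1/2}$ through the $n$ creation operators of the ket costs $(-1)^n$ and leaves
$\psi_{-1/2}|0\rangle$, which $e^{H[s]}$ fixes. In the bra,
$\langle0|=\langle0|\psi^*_{-1/2}\psi_{-1/2}$ supplies an $n$-th annihilation operator, which stands
for the part $\mu_n=0$ (`bra_one_eq`). Wick's theorem (`prod_reverse_smul_prod_smul`) then gives the
determinant of the anticommutators, which are the $h_k$ at differences of positions. The ket has one
charge more than the bra, whence the $+1$ in the index and the shape $\lambda+(1^n)$.

Combinatorial side. With letters $1<1'$, a primed letter can only end a row, and a cell below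
another one must be primed. A tableau is thus an independent choice, row by row, of the last letter,
and the sum over tableaux is a product of row factors (`superSchur_eq_prod_rowFactor`). The
determinant is the same product (`det_superH`): as $h_{m+k}=x^mh_k$ for $k>0$, row operations clear
the last row or column outside the corner. -/

theorem aeval_hsymm_one_var (x : R) (i : ℕ) :
    MvPolynomial.aeval ![x] (MvPolynomial.hsymm (Fin 1) ℤ i) = x ^ i := by
  rw [MvPolynomial.hsymm, map_sum, Fintype.sum_eq_single (Sym.replicate i (0 : Fin 1))]
  · simp [Sym.replicate, Multiset.map_replicate, Multiset.prod_replicate]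
  · intro s hs
    exact absurd (Subsingleton.elim s _) hs

theorem aeval_esymm_one_var (y : R) (i : ℕ) :
    MvPolynomial.aeval ![y] (MvPolynomial.esymm (Fin 1) ℤ i) =
      if i = 0 then 1 else if i = 1 then y else 0 := by
  rcases i with _ | _ | i
  · simp
  · simp [MvPolynomial.esymm_one]
  · rw [MvPolynomial.esymm, powersetCard_eq_empty.2 (by simp)]
    simp

theorem superH_of_neg (x y : R) {k : ℤ} (hk : k < 0) : superH ![x] ![y] k = 0 := by
  simp [superH, hk]

theorem superH_zero (x y : R) : superH ![x] ![y] 0 = 1 := by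
  simp [superH]

theorem superH_of_pos (x y : R) {k : ℤ} (hk : 0 < k) :
    superH ![x] ![y] k = (x + y) * x ^ (k - 1).toNat := by
  obtain ⟨m, rfl⟩ : ∃ m : ℕ, k = m + 1 := ⟨(k - 1).toNat, by omega⟩
  have h1 : ((m : ℤ) + 1).toNat = m + 1 := by omega
  have h2 : ((m : ℤ) + 1 - 1).toNat = m := by omega
  rw [superH, if_neg (by omega), h1, h2, sum_range_succ, sum_range_succ, sum_eq_zero]
  · simp only [aeval_hsymm_one_var, aeval_esymm_one_var]
    simp
    ring
  · intro i hi
    rw [mem_range] at hi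
    rw [aeval_esymm_one_var, if_neg (by omega), if_neg (by omega), mul_zero]

/-- Beyond degree zero the sequence $h_k=(x+y)x^{k-1}$ is geometric. The relation breaks down at `k
= 0`, where $h_0=1$; this exception produces the factors `y` in the determinant. -/
theorem superH_add (x y : R) {k m : ℤ} (hk : 0 < k) (hm : 0 ≤ m) :
    superH ![x] ![y] (m + k) = x ^ m.toNat * superH ![x] ![y] k := by
  rw [superH_of_pos x y hk, superH_of_pos x y (by omega),
    show (m + k - 1).toNat = m.toNat + (k - 1).toNat by omega, pow_add]
  ring

/-- The contribution of row `i` to the supersymmetric skew Schur function in one variable `x` and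
one variable `y`, in terms of the strictly decreasing sequences `A i = λ_i - i`, `B i = μ_i - i`. -/
noncomputable def rowFactor {n : ℕ} (x y : R) (A B : Fin n → ℤ) (i : Fin n) : R :=
  if A i < B i ∨ ∃ j : Fin n, (j : ℕ) + 1 = i ∧ B j < A i then 0
  else if ∃ j : Fin n, (j : ℕ) + 1 = i ∧ B j = A i then y * x ^ (A i - B i - 1).toNat
  else superH ![x] ![y] (A i - B i)

theorem exists_castSucc_add_one {n : ℕ} (p : Fin (n + 1) → Prop) (i : Fin n) :
    (∃ j : Fin (n + 1), (j : ℕ) + 1 = i.castSucc ∧ p j) ↔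
      ∃ j : Fin n, (j : ℕ) + 1 = i ∧ p j.castSucc := by
  constructor
  · rintro ⟨j, hj, h⟩
    rw [Fin.val_castSucc] at hj
    exact ⟨⟨j, by omega⟩, hj, h⟩
  · rintro ⟨j, hj, h⟩
    exact ⟨j.castSucc, hj, h⟩

theorem exists_last_add_one {n : ℕ} (p : Fin (n + 2) → Prop) :
    (∃ j : Fin (n + 2), (j : ℕ) + 1 = Fin.last (n + 1) ∧ p j) ↔ p (Fin.last n).castSucc := by
  constructor
  · rintro ⟨j, hj, h⟩
    rwa [show (Fin.last n).castSucc = j from Fin.ext (by simp at hj ⊢; omega)]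
  · exact fun h => ⟨_, rfl, h⟩

theorem rowFactor_castSucc {n : ℕ} (x y : R) (A B : Fin (n + 1) → ℤ) (i : Fin n) :
    rowFactor x y A B i.castSucc =
      rowFactor x y (A ∘ Fin.castSucc) (B ∘ Fin.castSucc) i := by
  simp only [rowFactor, exists_castSucc_add_one, Function.comp_apply]

theorem det_succ_of_last_column {n : ℕ} (M : Matrix (Fin (n + 1)) (Fin (n + 1)) R)
    (h : ∀ p : Fin n, M p.castSucc (Fin.last n) = 0) :
    M.det = (M.submatrix Fin.castSucc Fin.castSucc).det * M (Fin.last n) (Fin.last n) := by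
  rw [Matrix.det_succ_column M (Fin.last n), Fin.sum_univ_castSucc, sum_eq_zero]
  · simp [Fin.succAbove_last, mul_comm]
  · intro p _
    simp [h]

theorem det_succ_of_last_row {n : ℕ} (M : Matrix (Fin (n + 1)) (Fin (n + 1)) R)
    (h : ∀ q : Fin n, M (Fin.last n) q.castSucc = 0) :
    M.det = (M.submatrix Fin.castSucc Fin.castSucc).det * M (Fin.last n) (Fin.last n) := by
  rw [← Matrix.det_transpose, det_succ_of_last_column _ h, ← Matrix.det_transpose]
  rfl

/-- Induction splits off the last row and column. Either the last column vanishes above the corner,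
or subtracting a multiple of the preceding row clears the last row outside the corner. The corner
entry that remains is the last row factor. -/
theorem det_superH {n : ℕ} (x y : R) {A B : Fin n → ℤ} (hA : StrictAnti A) (hB : StrictAnti B) :
    (Matrix.of fun p q => superH ![x] ![y] (A q - B p)).det = ∏ i, rowFactor x y A B i := by
  induction n with
  | zero => simp
  | succ n ih =>
    have ih' := ih (A := A ∘ Fin.castSucc) (B := B ∘ Fin.castSucc)
      (fun i j h => hA (Fin.castSucc_lt_castSucc_iff.2 h))
      (fun i j h => hB (Fin.castSucc_lt_castSucc_iff.2 h))
    rw [Fin.prod_univ_castSucc]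
    simp only [rowFactor_castSucc]
    rw [← ih']
    have hBlast : ∀ p : Fin n, B (Fin.last n) < B p.castSucc := fun p => hB (Fin.castSucc_lt_last p)
    have hAlast : ∀ p : Fin n, A (Fin.last n) < A p.castSucc := fun p => hA (Fin.castSucc_lt_last p)
    by_cases h1 : A (Fin.last n) < B (Fin.last n)
    · rw [rowFactor, if_pos (Or.inl h1), mul_zero]
      refine Matrix.det_eq_zero_of_column_eq_zero (Fin.last n) fun p => superH_of_neg _ _ ?_
      have := hB.antitone (Fin.le_last p)
      omega
    by_cases h2 : ∀ p : Fin n, A (Fin.last n) < B p.castSucc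
    · rw [det_succ_of_last_column]
      · rw [rowFactor, if_neg, if_neg]
        · rfl
        · rintro ⟨j, hj, h⟩
          have := h2 ⟨j, by simp at hj; omega⟩
          simp at this
          omega
        · rintro (h | ⟨j, hj, h⟩)
          · exact h1 h
          · have := h2 ⟨j, by simp at hj; omega⟩
            simp at this
            omega
      · intro p
        exact superH_of_neg _ _ (by have := h2 p; omega)
    obtain _ | n := n
    · exact absurd (fun p => p.elim0) h2
    have h3 : B (Fin.last n).castSucc ≤ A (Fin.last (n + 1)) := by
      push Not at h2
      obtain ⟨p, hp⟩ := h2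
      exact (hB.antitone (Fin.castSucc_le_castSucc_iff.2 (Fin.le_last p))).trans hp
    have hBn := hBlast (Fin.last n)
    have key : ∀ q, B (Fin.last n).castSucc < A q →
        superH ![x] ![y] (A q - B (Fin.last (n + 1))) =
          x ^ (B (Fin.last n).castSucc - B (Fin.last (n + 1))).toNat *
            superH ![x] ![y] (A q - B (Fin.last n).castSucc) := by
      intro q hq
      rw [← superH_add _ _ (by omega) (by omega)]
      congr 1
      ring
    set c := x ^ (B (Fin.last n).castSucc - B (Fin.last (n + 1))).toNat with hc
    -- Every `A q` with `q` not last exceeds `A (Fin.last _)`, hence also `B` of the preceding row,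
    -- so `key` makes the two last rows proportional away from the corner.
    rw [← Matrix.det_updateRow_add_smul_self (Matrix.of fun p q => superH ![x] ![y] (A q - B p))
      (Fin.castSucc_lt_last (Fin.last n)).ne' (-c), det_succ_of_last_row]
    · congr 1
      · congr 1
        ext p q
        simp [Matrix.updateRow_apply, (Fin.castSucc_lt_last p).ne]
      · simp only [Matrix.updateRow_self, Pi.add_apply, Pi.smul_apply, Matrix.of_apply, smul_eq_mul]
        simp only [rowFactor, exists_last_add_one]
        rcases h3.lt_or_eq with h | h
        · rw [if_pos (Or.inr h), key _ h]
          ring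
        -- Here the entry above the corner is $h_0=1$, and with $m$ the difference of `A` and `B` at
        -- the last index the corner becomes $(x+y)x^{m-1}-x^m=yx^{m-1}$.
        · rw [if_neg (by omega), if_pos h, h, sub_self, superH_zero, superH_of_pos _ _ (by omega),
            hc, h, show (A (Fin.last (n + 1)) - B (Fin.last (n + 1))).toNat =
              (A (Fin.last (n + 1)) - B (Fin.last (n + 1)) - 1).toNat + 1 by omega, pow_succ]
          ring
    · intro q
      simp only [Matrix.updateRow_self, Pi.add_apply, Pi.smul_apply, Matrix.of_apply, smul_eq_mul]
      rw [key _ (h3.trans_lt (hAlast q))]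
      ring

/-! ### Supertableaux with the letters $1<1'$. -/

theorem mem_skewCells {n : ℕ} {lam mu : Fin n → ℕ} {c : Fin n × ℕ} :
    c ∈ skewCells lam mu ↔ mu c.1 ≤ c.2 ∧ c.2 < lam c.1 := by
  obtain ⟨i, j⟩ := c
  simp [skewCells]

theorem lex_eq_inl_or_inr (a : Fin 1 ⊕ₗ Fin 1) : a = Sum.inlₗ 0 ∨ a = Sum.inrₗ 0 := by
  rcases h : ofLex a with b | b
  · exact Or.inl (by rw [Subsingleton.elim 0 b, Sum.inlₗ, ← h]; rfl)
  · exact Or.inr (by rw [Subsingleton.elim 0 b, Sum.inrₗ, ← h]; rfl)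

theorem inlₗ_ne_inrₗ : (Sum.inlₗ 0 : Fin 1 ⊕ₗ Fin 1) ≠ Sum.inrₗ 0 := by
  intro h
  cases toLex.injective h

theorem inlₗ_le_lex (a : Fin 1 ⊕ₗ Fin 1) : Sum.inlₗ 0 ≤ a := by
  rcases lex_eq_inl_or_inr a with rfl | rfl
  · exact le_rfl
  · exact (Sum.Lex.inl_lt_inr _ _).le

theorem lex_le_inrₗ (a : Fin 1 ⊕ₗ Fin 1) : a ≤ Sum.inrₗ 0 := by
  rcases lex_eq_inl_or_inr a with rfl | rfl
  · exact (Sum.Lex.inl_lt_inr _ _).le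
  · exact le_rfl

theorem eq_inrₗ_of_le {a : Fin 1 ⊕ₗ Fin 1} (h : Sum.inrₗ 0 ≤ a) : a = Sum.inrₗ 0 :=
  le_antisymm (lex_le_inrₗ a) h

section rows

variable {n : ℕ} (lam mu : Fin n → ℕ)

/-- For tableaux with letters `1 < 1'`, the possible answers to the question whether row `i` ends
with a primed letter; empty rows are recorded as `false`. -/
def allowedEnds (i : Fin n) : Finset Bool :=
  if ∃ j : Fin n, (j : ℕ) + 1 = i ∧ mu j + 1 < lam i then ∅
  else if ∃ j : Fin n, (j : ℕ) + 1 = i ∧ mu j + 1 = lam i then {true}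
  else if mu i = lam i then {false}
  else univ

/-- The filling with letters `1 < 1'` whose primed letters are the last letters of the rows `i`
with `e i = true`. -/
def endFilling (e : Fin n → Bool) : skewCells lam mu → Fin 1 ⊕ₗ Fin 1 :=
  fun c => if e c.1.1 = true ∧ c.1.2 + 1 = lam c.1.1 then Sum.inrₗ 0 else Sum.inlₗ 0

variable {lam mu}

/-- Rows are fine because only a last cell can be primed. In a column, the lower of two cells lies
in the overlap of its row with the row just above; `allowedEnds` admits an overlap of one column
only, and then forces that cell to be primed. -/
theorem isSupertableau_endFilling (hmu : Antitone mu) {e : Fin n → Bool}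
    (he : ∀ i, e i ∈ allowedEnds lam mu i) : IsSupertableau (endFilling lam mu e) := by
  refine ⟨?_, ?_⟩
  · rintro ⟨⟨i, j⟩, hc⟩ ⟨⟨i', j'⟩, hd⟩ hi hj
    dsimp only at hi hj
    subst hi
    have hT : endFilling lam mu e ⟨(i, j), hc⟩ = Sum.inlₗ 0 := by
      have := (mem_skewCells.1 hd).2
      exact if_neg fun h => by dsimp only at this h; omega
    rw [hT]
    refine ⟨inlₗ_le_lex _, fun k h => ?_⟩
    rw [Subsingleton.elim k 0] at h
    exact inlₗ_ne_inrₗ h.1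
  · rintro ⟨⟨i, j⟩, hc⟩ ⟨⟨i', j'⟩, hd⟩ hj hi
    dsimp only at hi hj
    subst hj
    rw [mem_skewCells] at hc hd
    dsimp only at hc hd
    rw [Fin.lt_def] at hi
    have hT : endFilling lam mu e ⟨(i', j), mem_skewCells.2 hd⟩ = Sum.inrₗ 0 := by
      -- The two cells need not lie in adjacent rows, but monotonicity of `mu` places column `j` in
      -- the overlap with row `i' - 1` too.
      let k : Fin n := ⟨i' - 1, by omega⟩
      have hk : (k : ℕ) + 1 = i' := by simp only [k]; omega
      have hmk : mu k ≤ mu i := hmu (Fin.le_def.2 (by omega))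
      have h := he i'
      rw [allowedEnds] at h
      split_ifs at h with h1 h2 h3
      · simp at h
      · have : mu k + 1 = lam i' := by
          obtain ⟨l, hl, hl'⟩ := h2
          rwa [show k = l from Fin.ext (by omega)]
        exact if_pos ⟨by simpa using h, by dsimp only; omega⟩
      · exact absurd h3 (by omega)
      · exfalso
        have h4 : ¬ mu k + 1 < lam i' := fun h => h1 ⟨k, hk, h⟩
        have h5 : ¬ mu k + 1 = lam i' := fun h => h2 ⟨k, hk, h⟩
        omega
    rw [hT]
    refine ⟨lex_le_inrₗ _, fun k h => ?_⟩
    rw [Subsingleton.elim k 0] at h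
    exact inlₗ_ne_inrₗ h.2.symm

/-- The last cell of a nonempty row reveals `e i`. An empty row shows nothing, but there
`allowedEnds` leaves only `false`. -/
theorem endFilling_injOn (hmu : Antitone mu) (h : ∀ i, mu i ≤ lam i) {e e' : Fin n → Bool}
    (he : ∀ i, e i ∈ allowedEnds lam mu i) (he' : ∀ i, e' i ∈ allowedEnds lam mu i)
    (hee : endFilling lam mu e = endFilling lam mu e') : e = e' := by
  funext i
  rcases (h i).eq_or_lt with hi | hi
  · have hf : ∀ b ∈ allowedEnds lam mu i, b = false := by
      intro b hb
      rw [allowedEnds] at hb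
      split_ifs at hb with h1 h2
      · simp at hb
      · obtain ⟨j, hj, hj'⟩ := h2
        have := hmu (show j ≤ i from Fin.le_def.2 (by omega))
        omega
      · simpa using hb
    rw [hf _ (he i), hf _ (he' i)]
  · have := congrFun hee ⟨(i, lam i - 1), mem_skewCells.2 ⟨by dsimp only; omega,
      by dsimp only; omega⟩⟩
    simp only [endFilling, show lam i - 1 + 1 = lam i by omega, and_true] at this
    cases h1 : e i <;> cases h2 : e' i <;> simp only [h1, h2, if_true] at this ⊢
    · exact absurd this (by simp)
    · exact absurd this (by simp)

theorem IsSupertableau.exists_endFilling (hlam : Antitone lam) (hmu : Antitone mu)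
    {T : skewCells lam mu → Fin 1 ⊕ₗ Fin 1} (hT : IsSupertableau T) :
    ∃ e : Fin n → Bool, (∀ i, e i ∈ allowedEnds lam mu i) ∧ endFilling lam mu e = T := by
  classical
  -- Only $1'$ could follow $1'$ in a row, and it may not repeat there.
  have hend : ∀ c, T c = Sum.inrₗ 0 → c.1.2 + 1 = lam c.1.1 := by
    rintro ⟨⟨i, j⟩, hc⟩ h
    by_contra hne
    have hc' := mem_skewCells.1 hc
    dsimp only at hc' hne
    have hd : (i, j + 1) ∈ skewCells lam mu :=
      mem_skewCells.2 ⟨by dsimp only; omega, by dsimp only; omega⟩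
    obtain ⟨h1, h2⟩ := hT.1 ⟨(i, j), hc⟩ ⟨(i, j + 1), hd⟩ rfl (Nat.lt_succ_self j)
    rw [h] at h1
    exact h2 0 ⟨h, eq_inrₗ_of_le h1⟩
  -- An unprimed cell would force the cell above it to be unprimed as well, a repetition in the
  -- column.
  have hoverlap : ∀ j i : Fin n, (j : ℕ) + 1 = i → ∀ k (hk : mu j ≤ k) (hk' : k < lam i),
      ∃ hd : (i, k) ∈ skewCells lam mu, T ⟨(i, k), hd⟩ = Sum.inrₗ 0 := by
    intro j i hji k hk hk'
    have hle : j ≤ i := Fin.le_def.2 (by omega)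
    have hd : (i, k) ∈ skewCells lam mu := mem_skewCells.2 ⟨(hmu hle).trans hk, hk'⟩
    have hc : (j, k) ∈ skewCells lam mu := mem_skewCells.2 ⟨hk, hk'.trans_le (hlam hle)⟩
    refine ⟨hd, ?_⟩
    obtain ⟨h1, h2⟩ := hT.2 ⟨(j, k), hc⟩ ⟨(i, k), hd⟩ rfl (Fin.lt_def.2 (by dsimp only; omega))
    rcases lex_eq_inl_or_inr (T ⟨(i, k), hd⟩) with h | h
    · rw [h] at h1
      exact absurd ⟨le_antisymm h1 (inlₗ_le_lex _), h⟩ (h2 0)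
    · exact h
  refine ⟨fun i => decide (∃ c, c.1.1 = i ∧ T c = Sum.inrₗ 0), fun i => ?_, ?_⟩
  · rw [allowedEnds]
    split_ifs with h1 h2 h3
    · obtain ⟨j, hj, hlt⟩ := h1
      -- With two or more columns of overlap, the first one carries a primed letter that does not
      -- end its row.
      obtain ⟨hd, h⟩ := hoverlap j i hj (mu j) le_rfl (by omega)
      have := hend _ h
      dsimp only at this
      omega
    · obtain ⟨j, hj, heq⟩ := h2
      obtain ⟨hd, h⟩ := hoverlap j i hj (mu j) le_rfl (by omega)
      rw [mem_singleton, decide_eq_true_eq]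
      exact ⟨_, rfl, h⟩
    · rw [mem_singleton, decide_eq_false_iff_not]
      rintro ⟨c, rfl, -⟩
      have := mem_skewCells.1 c.2
      omega
    · exact mem_univ _
  · funext c
    rw [endFilling]
    rcases lex_eq_inl_or_inr (T c) with h | h
    · rw [h]
      refine if_neg ?_
      rw [decide_eq_true_eq]
      rintro ⟨⟨d, hd1, hd⟩, hc⟩
      have hd2 := hend d hd
      rw [hd1] at hd2
      rw [show d = c from Subtype.ext (Prod.ext hd1 (by omega)), h] at hd
      exact inlₗ_ne_inrₗ hd
    · rw [h]
      refine if_pos ⟨?_, hend c h⟩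
      rw [decide_eq_true_eq]
      exact ⟨c, rfl, h⟩

theorem prod_Ico_ite_last (x y : R) {m l : ℕ} (h : m < l) (p : Prop) [Decidable p] :
    (∏ k ∈ Ico m l, if p ∧ k + 1 = l then y else x) =
      (if p then y else x) * x ^ (l - m - 1) := by
  obtain ⟨d, rfl⟩ : ∃ d, l = m + d + 1 := ⟨l - m - 1, by omega⟩
  rw [prod_Ico_succ_top (by omega), prod_congr rfl (g := fun _ => x), prod_const,
    Nat.card_Ico, show m + d + 1 - m - 1 = d by omega, Nat.add_sub_cancel_left, mul_comm]
  · simp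
  · intro k hk
    rw [mem_Ico] at hk
    exact if_neg fun h => by omega

theorem prod_endFilling (x y : R) (h : ∀ i, mu i ≤ lam i) (e : Fin n → Bool) :
    ∏ c, Sum.elim ![x] ![y] (ofLex (endFilling lam mu e c)) =
      ∏ i, if mu i = lam i then 1
        else (if e i = true then y else x) * x ^ (lam i - mu i - 1) := by
  have h1 : ∀ c, Sum.elim ![x] ![y] (ofLex (endFilling lam mu e c)) =
      (fun c : Fin n × ℕ => if e c.1 = true ∧ c.2 + 1 = lam c.1 then y else x) c.1 := by
    intro c
    dsimp only [endFilling]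
    split_ifs <;> rfl
  rw [prod_congr rfl fun c _ => h1 c, prod_coe_sort (skewCells lam mu)
    (fun c : Fin n × ℕ => if e c.1 = true ∧ c.2 + 1 = lam c.1 then y else x), skewCells,
    prod_biUnion]
  · refine prod_congr rfl fun i _ => ?_
    rw [prod_image (fun a _ b _ hab => (Prod.ext_iff.1 hab).2)]
    split_ifs with h2 h3
    · simp [h2]
    · exact (prod_Ico_ite_last x y ((h i).lt_of_ne h2) (e i = true)).trans (by rw [if_pos h3])
    · exact (prod_Ico_ite_last x y ((h i).lt_of_ne h2) (e i = true)).trans (by rw [if_neg h3])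
  · intro i _ j _ hij
    rw [Function.onFun, disjoint_left]
    simp only [mem_image]
    rintro _ ⟨a, _, rfl⟩ ⟨b, _, hb⟩
    exact hij (Prod.ext_iff.1 hb).1.symm

/-- A row of length $m>0$ without overlap has a free last letter and contributes $(x+y)x^{m-1}=h_m$;
with one column of overlap only the primed ending survives, giving $yx^{m-1}$. -/
theorem sum_allowedEnds (x y : R) (hmu : Antitone mu) {i : Fin n} (h : mu i ≤ lam i) :
    (∑ b ∈ allowedEnds lam mu i, if mu i = lam i then 1
        else (if b = true then y else x) * x ^ (lam i - mu i - 1)) =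
      rowFactor x y (fun i => (lam i : ℤ) - i) (fun i => (mu i : ℤ) - i) i := by
  have h1 : (∃ j : Fin n, (j : ℕ) + 1 = i ∧ (mu j : ℤ) - j < (lam i : ℤ) - i) ↔
      ∃ j : Fin n, (j : ℕ) + 1 = i ∧ mu j + 1 < lam i :=
    exists_congr fun j => and_congr_right fun hj => by omega
  have h2 : (∃ j : Fin n, (j : ℕ) + 1 = i ∧ (mu j : ℤ) - j = (lam i : ℤ) - i) ↔
      ∃ j : Fin n, (j : ℕ) + 1 = i ∧ mu j + 1 = lam i :=
    exists_congr fun j => and_congr_right fun hj => by omega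
  simp only [rowFactor, h1, h2, allowedEnds, show ¬ (lam i : ℤ) - i < (mu i : ℤ) - i by omega,
    false_or]
  by_cases h3 : ∃ j : Fin n, (j : ℕ) + 1 = i ∧ mu j + 1 < lam i
  · simp [h3]
  by_cases h4 : ∃ j : Fin n, (j : ℕ) + 1 = i ∧ mu j + 1 = lam i
  · have h5 : mu i ≠ lam i := by
      obtain ⟨j, hj, hj'⟩ := h4
      have := hmu (show j ≤ i from Fin.le_def.2 (by omega))
      omega
    simp only [if_neg h3, if_pos h4, sum_singleton, if_neg h5, if_true]
    congr 2
    omega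
  simp only [if_neg h3, if_neg h4]
  by_cases h5 : mu i = lam i
  · simp only [if_pos h5, sum_singleton]
    rw [show (lam i : ℤ) - i - ((mu i : ℤ) - i) = 0 by omega, superH_zero]
  · simp only [if_neg h5]
    rw [superH_of_pos _ _ (by omega), Fintype.sum_bool,
      show ((lam i : ℤ) - i - ((mu i : ℤ) - i) - 1).toNat = lam i - mu i - 1 by omega]
    simp
    ring

theorem superSchur_eq_prod_rowFactor (x y : R) (hlam : Antitone lam) (hmu : Antitone mu) :
    superSchur lam mu ![x] ![y] =
      ∏ i, rowFactor x y (fun i => (lam i : ℤ) - i) (fun i => (mu i : ℤ) - i) i := by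
  classical
  rw [superSchur]
  split_ifs with h
  -- Distributing the product over the rows turns it into a sum over all choices of endings, which
  -- `endFilling` matches with the tableaux.
  · rw [← prod_congr rfl fun i _ => sum_allowedEnds x y hmu (h i), prod_univ_sum,
      ← sum_congr rfl fun e _ => prod_endFilling x y h e,
      ← sum_image (f := fun T : skewCells lam mu → Fin 1 ⊕ₗ Fin 1 =>
        ∏ c, Sum.elim ![x] ![y] (ofLex (T c))) (g := endFilling lam mu)]
    · refine sum_congr ?_ fun _ _ => rfl
      ext T
      simp only [mem_filter, mem_univ, true_and, mem_image, Fintype.mem_piFinset]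
      refine ⟨fun hT => hT.exists_endFilling hlam hmu, ?_⟩
      rintro ⟨e, he, rfl⟩
      exact isSupertableau_endFilling hmu he
    · intro e he e' he' hee
      exact endFilling_injOn hmu h (Fintype.mem_piFinset.1 he) (Fintype.mem_piFinset.1 he') hee
  · push Not at h
    obtain ⟨i, hi⟩ := h
    refine (prod_eq_zero (mem_univ i) ?_).symm
    rw [rowFactor, if_pos (Or.inl (by omega))]

/-- The Jacobi–Trudi formula for the supersymmetric skew Schur functions in one variable `x` and
one variable `y`. -/
theorem superSchur_eq_det (x y : R) (hlam : Antitone lam) (hmu : Antitone mu) :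
    superSchur lam mu ![x] ![y] =
      (Matrix.of fun p q : Fin n =>
        superH ![x] ![y] (((lam q : ℤ) - q) - ((mu p : ℤ) - p))).det := by
  rw [superSchur_eq_prod_rowFactor x y hlam hmu]
  refine (det_superH x y ?_ ?_).symm
  · intro i j hij
    have := hlam hij.le
    have := Fin.lt_def.1 hij
    dsimp only
    omega
  · intro i j hij
    have := hmu hij.le
    have := Fin.lt_def.1 hij
    dsimp only
    omega

end rows

end SuperSchur

/-! ### The generating function of the $h_k(x\mid y)$. -/

namespace Fermion

open SuperSchur PowerSeries

variable {R : Type*} [CommRing R] [Algebra ℚ R]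

/-- The coefficient of $z^n$ reads $(n+1)w_{n+1}+nyw_n=yw_n$, and $n+1$ is invertible over $\mathbb
Q$, so $w_0=0$ propagates. -/
theorem eq_zero_of_one_add_mul_derivative_eq (y : R) {w : PowerSeries R}
    (h : (1 + C y * X) * derivative R w = C y * w) (h0 : constantCoeff w = 0) : w = 0 := by
  ext n
  rw [map_zero]
  induction n with
  | zero => simpa using h0
  | succ n ih =>
    have key := congrArg (coeff n) h
    have h1 : coeff n (X * derivative R w) = 0 := by
      cases n with
      | zero => simp
      | succ n => rw [coeff_succ_X_mul, coeff_derivative, ih, zero_mul]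
    rw [add_mul, one_mul, mul_assoc, map_add, coeff_C_mul, coeff_C_mul, h1, ih, mul_zero, add_zero,
      coeff_derivative] at key
    have hu : IsUnit ((n : R) + 1) := by
      have := (isUnit_iff_ne_zero.2 (Nat.cast_add_one_ne_zero (R := ℚ) n)).map (algebraMap ℚ R)
      simpa using this
    exact (hu.mul_left_eq_zero).1 key

theorem mul_superTime (x y : R) (q : ℕ) :
    superTime x y (q + 1) * (q + 1) = x ^ (q + 1) - (-y) ^ (q + 1) := by
  have h : algebraMap ℚ R (1 / ((q + 1 : ℕ) : ℚ)) * (q + 1) = 1 := by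
    have h1 : ((q : R) + 1) = algebraMap ℚ R ((q + 1 : ℕ) : ℚ) := by simp
    rw [h1, ← map_mul, one_div_mul_cancel (Nat.cast_ne_zero.2 q.succ_ne_zero), map_one]
  rw [superTime, mul_right_comm, h, one_mul]

theorem superTime_zero (x y : R) : superTime x y 0 = 0 := by
  simp [superTime]

theorem constantCoeff_superTime (x y : R) : constantCoeff (mk (superTime x y)) = 0 := by
  rw [← coeff_zero_eq_constantCoeff_apply, coeff_mk, superTime_zero]

/-- This is $\frac{d}{dz}\sum_q s_qz^q=\frac{x}{1-xz}+\frac{y}{1+yz}$ with denominators cleared. -/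
theorem derivative_superTime (x y : R) :
    (1 - C x * X) * (1 + C y * X) * derivative R (mk (superTime x y)) =
      C x * (1 + C y * X) + C y * (1 - C x * X) := by
  have hgeom : ∀ a : R, (1 - C a * X) * mk (fun n => a ^ (n + 1)) = C a := by
    intro a
    ext n
    rw [sub_mul, one_mul, mul_assoc, map_sub, coeff_C_mul, coeff_mk]
    cases n with
    | zero => simp
    | succ n => simp [coeff_succ_X_mul, pow_succ']
  have hd : derivative R (mk (superTime x y)) =
      mk (fun n => x ^ (n + 1)) - mk (fun n => (-y) ^ (n + 1)) := by
    ext n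
    rw [coeff_derivative, coeff_mk, mul_superTime, map_sub, coeff_mk, coeff_mk]
  have hy := hgeom (-y)
  rw [map_neg, neg_mul, sub_neg_eq_add] at hy
  rw [hd]
  linear_combination (1 + C y * X) * hgeom x - (1 - C x * X) * hy

/-- The generating function of the complete supersymmetric functions in one variable `x` and one
variable `y` is the exponential of the series `∑ s_q z^q`. -/
theorem exp_subst_superTime (x y : R) :
    (exp R).subst (mk (superTime x y)) = mk fun k : ℕ => superH ![x] ![y] k := by
  have hS : HasSubst (mk (superTime x y)) :=
    HasSubst.of_constantCoeff_zero' (constantCoeff_superTime x y)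
  set E : PowerSeries R := (exp R).subst (mk (superTime x y)) with hE
  have hE0 : constantCoeff E = 1 := by
    rw [hE, ← coeff_zero_eq_constantCoeff_apply, coeff_subst' hS, finsum_eq_single _ 0]
    · simp
    · intro n hn
      rw [coeff_zero_eq_constantCoeff_apply, map_pow, constantCoeff_superTime, zero_pow hn,
        smul_zero]
  have hE' : derivative R E = E * derivative R (mk (superTime x y)) := by
    rw [hE, derivative_subst hS, derivative_exp]
  -- The difference $w$ of the two sides has no constant term and satisfies $(1+yz)w'=yw$, by the
  -- formula for the derivative of the exponent.
  have key : (1 - C x * X) * E = 1 + C y * X := by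
    refine sub_eq_zero.1 (eq_zero_of_one_add_mul_derivative_eq y ?_ (by simp [hE0]))
    simp only [map_sub, map_add, Derivation.leibniz, derivative_one, derivative_C, derivative_X,
      smul_eq_mul, hE']
    linear_combination E * derivative_superTime x y
  ext n
  rw [coeff_mk]
  have hrec : ∀ n, coeff (n + 1) E = x * coeff n E + if n = 0 then y else 0 := by
    intro n
    have h := congrArg (coeff (n + 1)) key
    rw [sub_mul, one_mul, mul_assoc, map_sub, coeff_C_mul, coeff_succ_X_mul, map_add,
      coeff_C_mul, coeff_one, if_neg n.succ_ne_zero, zero_add, coeff_X] at h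
    simp only [Nat.add_eq_right, mul_ite, mul_one, mul_zero] at h
    rw [← h]
    ring
  induction n with
  | zero => simpa [superH_zero] using hE0
  | succ n ih =>
    rw [hrec, ih]
    cases n with
    | zero => simp [superH_zero, superH_of_pos x y (k := 1) one_pos]
    | succ n =>
      rw [superH_of_pos _ _ (by omega), superH_of_pos _ _ (by omega),
        show (((n + 1 + 1 : ℕ) : ℤ) - 1).toNat = n + 1 by omega,
        show (((n + 1 : ℕ) : ℤ) - 1).toNat = n by omega]
      simp
      ring

theorem superTime_mul_self (x t : R) (q : ℕ) : superTime x (t * x) q = sPlus ![x] ![t] q := by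
  simp only [superTime, sPlus, Finset.univ_unique, Fin.default_eq_zero, Finset.sum_singleton,
    Matrix.cons_val_zero, sub_mul, one_mul, ← mul_pow, neg_mul]

end Fermion

/-! ### Wick's theorem. -/

namespace Fermion

open Finset PowerSeries

section Wick

variable {R A V : Type*} [CommRing R] [Ring A] [Algebra R A] [AddCommGroup V] [Module R V]
  [Module A V] [IsScalarTower R A V]

theorem smul_comm_of_algebra (a : A) (r : R) (v : V) : a • r • v = r • a • v := by
  rw [← algebraMap_smul A, smul_smul, ← Algebra.commutes, mul_smul, algebraMap_smul]

/-- The operator `a` moves to the right until it kills `v`; each factor passed changes the sign and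
leaves one contraction. -/
theorem smul_prod_ofFn_smul {n : ℕ} (a : A) (f : Fin (n + 1) → A) (m : Fin (n + 1) → R)
    (h : ∀ q, a * f q + f q * a = algebraMap R A (m q)) {v : V} (hv : a • v = 0) :
    a • (List.ofFn f).prod • v =
      ∑ q : Fin (n + 1), ((-1) ^ (q : ℕ) * m q) • (List.ofFn fun i => f (q.succAbove i)).prod • v := by
  have hswap : ∀ (q) (w : V), a • f q • w = m q • w - f q • a • w := by
    intro q w
    rw [smul_smul, smul_smul, eq_sub_iff_add_eq, ← add_smul, h, algebraMap_smul]
  induction n with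
  | zero => simp [hswap, hv]
  | succ n ih =>
    rw [List.ofFn_succ, List.prod_cons, mul_smul, hswap,
      ih (fun i => f i.succ) (fun i => m i.succ) (fun q => h q.succ) (fun q => hswap q.succ),
      Fin.sum_univ_succ (n := n + 1)]
    simp only [Fin.succAbove_zero, Fin.val_zero, pow_zero, one_mul, smul_sum, sub_eq_add_neg,
      ← sum_neg_distrib]
    congr 1
    refine sum_congr rfl fun q _ => ?_
    rw [List.ofFn_succ (f := fun i => f (q.succ.succAbove i)), List.prod_cons, mul_smul,
      smul_comm_of_algebra]
    simp only [Fin.succ_succAbove_zero, Fin.succ_succAbove_succ, Fin.val_succ, pow_succ, mul_neg,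
      mul_one, neg_mul, neg_smul]
    rw [mul_smul, mul_smul, smul_comm_of_algebra (f 0) (m q.succ)]

/-- Wick's theorem for a product of annihilation operators followed by a product of creation
operators. -/
theorem prod_reverse_smul_prod_smul {n : ℕ} (e f : Fin n → A) (m : Matrix (Fin n) (Fin n) R)
    (h : ∀ p q, e p * f q + f q * e p = algebraMap R A (m p q)) {v : V}
    (hv : ∀ p, e p • v = 0) :
    (List.ofFn e).reverse.prod • (List.ofFn f).prod • v = m.det • v := by
  induction n with
  | zero => simp
  | succ n ih =>
    -- Thanks to the reversal `e 0` stands next to the creation operators. Contracting it yields the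
    -- Laplace expansion along row `0`, with no extra sign.
    rw [List.ofFn_succ, List.reverse_cons, List.prod_append, List.prod_singleton, mul_smul,
      smul_prod_ofFn_smul (e 0) f (m 0) (h 0) (hv 0), smul_sum, Matrix.det_succ_row_zero, sum_smul]
    refine sum_congr rfl fun q _ => ?_
    rw [smul_comm_of_algebra,
      ih _ _ (m.submatrix Fin.succ q.succAbove) (fun p r => h p.succ (q.succAbove r))
      (fun p => hv p.succ), smul_smul]

theorem mul_prod_ofFn_of_anticommute {n : ℕ} (a : A) (f : Fin n → A)
    (h : ∀ q, a * f q + f q * a = 0) :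
    a * (List.ofFn f).prod = (-1) ^ n * ((List.ofFn f).prod * a) := by
  induction n with
  | zero => simp
  | succ n ih =>
    rw [List.ofFn_succ, List.prod_cons, ← mul_assoc, eq_neg_of_add_eq_zero_left (h 0), neg_mul,
      mul_assoc, ih _ fun q => h q.succ, pow_succ, mul_assoc, neg_mul, one_mul,
      ← mul_assoc (f 0), ((Commute.neg_one_right (f 0)).pow_right n).eq]
    noncomm_ring

end Wick

/-! ### Conjugation of creation operators by $e^{H[t]}$. -/

variable {R : Type*} [CommRing R]

/-- The truncation `∑_{j < D} c_j ψ*_{a-j}` of the action of the power series `∑ c_j z^j` on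
creation operators. -/
noncomputable def creationSeries (D : ℕ) (a : ℤ) : PowerSeries R →ₗ[R] Alg R where
  toFun f := ∑ j ∈ range D, coeff j f • psiStar (a - j)
  map_add' f g := by simp only [map_add, add_smul, sum_add_distrib]
  map_smul' r f := by simp only [map_smul, smul_assoc, smul_sum, RingHom.id_apply]

theorem creationSeries_apply (D : ℕ) (a : ℤ) (f : PowerSeries R) :
    creationSeries D a f = ∑ j ∈ range D, coeff j f • (psiStar (a - j) : Alg R) := rfl

theorem creationSeries_one {D : ℕ} (hD : 0 < D) (a : ℤ) :
    creationSeries D a (1 : PowerSeries R) = psiStar a := by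
  rw [creationSeries_apply, sum_eq_single_of_mem 0 (mem_range.2 hD)]
  · simp
  · intro j _ hj
    rw [coeff_one, if_neg hj, zero_smul]

theorem psi_mul_creationSeries (D : ℕ) (a b : ℤ) (hD : a - b < D) (f : PowerSeries R) :
    psi b * creationSeries D a f + creationSeries D a f * psi b =
      algebraMap R (Alg R) (if a < b then 0 else coeff (a - b).toNat f) := by
  rw [creationSeries_apply, mul_sum, sum_mul, ← sum_add_distrib]
  have h : ∀ j : ℕ, psi b * coeff j f • psiStar (a - j) + coeff j f • psiStar (a - j) * psi b =
      coeff j f • (if b = a - j then 1 else 0 : Alg R) := by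
    intro j
    rw [mul_smul_comm, smul_mul_assoc, ← smul_add, psi_mul_psiStar]
  simp only [h]
  split_ifs with hab
  · rw [map_zero]
    exact sum_eq_zero fun j _ => by rw [if_neg (by omega), smul_zero]
  · rw [sum_eq_single_of_mem (a - b).toNat (mem_range.2 (by omega)), if_pos (by omega),
      Algebra.algebraMap_eq_smul_one]
    intro j _ hj
    rw [if_neg (by omega), smul_zero]

/-- In the sum defining $J_{q+1}$, only the term $i=a$ has a contraction with $\psi^*_a$. -/
theorem J_psiStar_smul (q : ℕ) (a : ℤ) (v : Fock R) :
    J (q + 1 : ℤ) ((psiStar a : Alg R) • v) =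
      (psiStar a : Alg R) • J (q + 1 : ℤ) v + (psiStar (a - (q + 1 : ℤ)) : Alg R) • v := by
  change (∑ᶠ i : ℤ, (normalOrdered (i - (q + 1 : ℤ)) i : Alg R) • (psiStar a : Alg R) • v) =
    (psiStar a : Alg R) • (∑ᶠ i : ℤ, (normalOrdered (i - (q + 1 : ℤ)) i : Alg R) • v) + _
  have h : ∀ i : ℤ, (normalOrdered (i - (q + 1 : ℤ)) i : Alg R) • (psiStar a : Alg R) • v =
      (psiStar a : Alg R) • (normalOrdered (i - (q + 1 : ℤ)) i : Alg R) • v +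
        if i = a then (psiStar (a - (q + 1 : ℤ)) : Alg R) • v else 0 := by
    intro i
    rw [normalOrdered_smul_of_ne (by omega), normalOrdered_smul_of_ne (by omega),
      psi_smul_psiStar_smul, smul_sub, psiStar_smul_psiStar_smul a, sub_eq_add_neg, add_comm]
    split_ifs with hia
    · rw [hia]
    · rw [smul_zero]
  have hfin : (Function.support fun i : ℤ =>
      if i = a then (psiStar (a - (q + 1 : ℤ)) : Alg R) • v else 0).Finite :=
    (Set.finite_singleton a).subset fun i hi => by
      by_contra hc
      exact hi (if_neg hc)
  rw [finsum_congr h, finsum_add_distrib _ hfin, smul_finsum' _ (finite_support_J _ v)]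
  · congr 1
    rw [finsum_eq_single _ a fun i hi => if_neg hi, if_pos rfl]
  · exact (finite_support_J _ v).subset fun i hi hc => hi (by dsimp only at hc ⊢; rw [hc, smul_zero])

/-- The commutator is $\sum_q t_q\psi^*_{k-q}$. The cutoff `D` loses nothing, since for $q\ge D$ the
position $k-q$ lies below `a` and $\psi^*_{k-q}$ kills `v`. -/
theorem H_psiStar_smul {a b : ℤ} {v : Fock R} (hv : IsBounded a b v) {t : ℕ → R} (ht : t 0 = 0)
    {D : ℕ} (hD : 0 < D) {k : ℤ} (hk : k - D < a) :
    H t ((psiStar k : Alg R) • v) =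
      (psiStar k : Alg R) • H t v + creationSeries D k (mk t) • v := by
  change (∑ᶠ q : ℕ, t (q + 1) • J (q + 1 : ℤ) ((psiStar k : Alg R) • v)) =
    (psiStar k : Alg R) • (∑ᶠ q : ℕ, t (q + 1) • J (q + 1 : ℤ) v) + _
  obtain ⟨D, rfl⟩ := Nat.exists_eq_succ_of_ne_zero hD.ne'
  have hsupp : (Function.support fun q : ℕ =>
      t (q + 1) • (psiStar (k - (q + 1 : ℤ)) : Alg R) • v) ⊆ range D := by
    intro q hq
    by_contra hc
    rw [mem_coe, mem_range] at hc
    exact hq (by dsimp only; rw [hv.1 _ (by push_cast at hk; omega), smul_zero])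
  have h : ∀ q : ℕ, t (q + 1) • J (q + 1 : ℤ) ((psiStar k : Alg R) • v) =
      (psiStar k : Alg R) • t (q + 1) • J (q + 1 : ℤ) v +
        t (q + 1) • (psiStar (k - (q + 1 : ℤ)) : Alg R) • v := by
    intro q
    rw [J_psiStar_smul, smul_add, smul_comm (t (q + 1)) (psiStar k : Alg R)]
  rw [finsum_congr h, finsum_add_distrib _ ((range D).finite_toSet.subset hsupp),
    smul_finsum' _ (finite_support_H t v), finsum_eq_sum_of_support_subset _ hsupp,
    creationSeries_apply, sum_range_succ', coeff_mk, ht, zero_smul, add_zero, sum_smul]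
  · simp only [coeff_mk, smul_assoc, Nat.cast_add, Nat.cast_one]
  · exact (finite_support_H t v).subset fun i hi hc => hi (by dsimp only at hc ⊢; rw [hc, smul_zero])

theorem H_creationSeries_smul {a b : ℤ} {v : Fock R} (hv : IsBounded a b v) {t : ℕ → R}
    (ht : t 0 = 0) {D : ℕ} {k : ℤ} (hk : k - D < a) (f : PowerSeries R) :
    H t (creationSeries D k f • v) =
      creationSeries D k f • H t v + creationSeries D k (mk t * f) • v := by
  have h : ∀ i ∈ range D, H t ((psiStar (k - i) : Alg R) • v) =
      (psiStar (k - i) : Alg R) • H t v +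
        ∑ j ∈ range (D - i), t j • (psiStar (k - (i + j : ℕ)) : Alg R) • v := by
    intro i hi
    rw [mem_range] at hi
    -- The cutoff `D - i` at position `k - i` keeps the total shift below `D`, so the double sum is
    -- the truncation of the product series.
    rw [H_psiStar_smul hv ht (D := D - i) (by omega) (by omega), creationSeries_apply, sum_smul]
    simp only [coeff_mk, smul_assoc, Nat.cast_add, sub_sub]
  simp only [creationSeries_apply, sum_smul, map_sum, smul_assoc, map_smul]
  rw [sum_congr rfl fun i hi => by rw [h i hi, smul_add], sum_add_distrib]
  congr 1
  simp only [smul_sum]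
  rw [← sum_range_diag_flip D fun i j =>
    coeff i f • t j • (psiStar (k - (i + j : ℕ)) : Alg R) • v]
  refine sum_congr rfl fun d _ => ?_
  rw [mul_comm, coeff_mul, Finset.Nat.sum_antidiagonal_eq_sum_range_succ_mk, sum_smul]
  refine sum_congr rfl fun i hi => ?_
  rw [mem_range] at hi
  rw [coeff_mk, mul_smul, Nat.add_sub_cancel' (by omega : i ≤ d)]

/-- Each commutator with `H t` multiplies the series by `mk t`, so this is the Leibniz rule for
iterated commutators; the induction step is Pascal's rule. -/
theorem H_pow_psiStar_smul {a b : ℤ} {v : Fock R} (hv : IsBounded a b v) {t : ℕ → R}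
    (ht : t 0 = 0) {D : ℕ} (hD : 0 < D) {k : ℤ} (hk : k - D < a) (m : ℕ) :
    (H t ^ m) ((psiStar k : Alg R) • v) =
      ∑ ij ∈ antidiagonal m,
        m.choose ij.1 • creationSeries D k (mk t ^ ij.1) • (H t ^ ij.2) v := by
  induction m with
  | zero => simp [creationSeries_one hD]
  | succ m ih =>
    rw [sum_antidiagonal_choose_succ_nsmul
      (fun i j => creationSeries D k (mk t ^ i) • (H t ^ j) v), pow_succ', Module.End.mul_apply,
      ih, map_sum, ← sum_add_distrib]
    refine sum_congr rfl fun ij hij => ?_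
    rw [map_nsmul, H_creationSeries_smul (hv.H_pow t _) ht hk, smul_add, ← pow_succ',
      Nat.choose_symm_of_eq_add (mem_antidiagonal.1 hij).symm, pow_succ' (H t),
      Module.End.mul_apply]

theorem coeff_pow_eq_zero {f : PowerSeries R} (hf : constantCoeff f = 0) {j k : ℕ} (h : j < k) :
    coeff j (f ^ k) = 0 :=
  X_pow_dvd_iff.1 (pow_dvd_pow_of_dvd (X_dvd_iff.2 hf) k) j h

theorem creationSeries_pow_eq_zero {f : PowerSeries R} (hf : constantCoeff f = 0) {D k : ℕ}
    (h : D ≤ k) (a : ℤ) : creationSeries D a (f ^ k) = 0 := by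
  rw [creationSeries_apply]
  refine sum_eq_zero fun j hj => ?_
  rw [mem_range] at hj
  rw [coeff_pow_eq_zero hf (by omega), zero_smul]

variable [Algebra ℚ R]

theorem expH_eq_sum {t : ℕ → R} {v : Fock R} {N M : ℕ} (hN : (H t ^ N) v = 0) (hNM : N ≤ M) :
    expH t v = ∑ k ∈ range M, algebraMap ℚ R (1 / (k.factorial : ℚ)) • (H t ^ k) v := by
  change ∑ᶠ k : ℕ, algebraMap ℚ R (1 / (k.factorial : ℚ)) • (H t ^ k) v = _
  refine finsum_eq_sum_of_support_subset _ fun k hk => ?_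
  by_contra hc
  rw [mem_coe, mem_range, not_lt] at hc
  refine hk ?_
  dsimp only
  rw [← Nat.sub_add_cancel (hNM.trans hc), pow_add, Module.End.mul_apply, hN, map_zero, smul_zero]

theorem creationSeries_exp_subst {f : PowerSeries R} (hf : constantCoeff f = 0) {D M : ℕ}
    (h : D ≤ M) (a : ℤ) :
    creationSeries D a ((exp R).subst f) =
      ∑ k ∈ range M, algebraMap ℚ R (1 / (k.factorial : ℚ)) • creationSeries D a (f ^ k) := by
  simp only [creationSeries_apply, smul_sum]
  rw [sum_comm]
  refine sum_congr rfl fun j hj => ?_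
  rw [mem_range] at hj
  rw [coeff_subst' (HasSubst.of_constantCoeff_zero' hf), finsum_eq_sum_of_support_subset
    (s := range M), sum_smul]
  · simp only [coeff_exp, smul_assoc]
  · intro k hk
    by_contra hc
    rw [mem_coe, mem_range, not_lt] at hc
    exact hk (by dsimp only; rw [coeff_pow_eq_zero hf (by omega), smul_zero])

/-- Conjugation by `e^{H[t]}` multiplies the generating series of the creation operators by
`exp (∑ t_q z^q)`. -/
theorem expH_psiStar_smul {a b : ℤ} {v : Fock R} (hv : IsBounded a b v) {t : ℕ → R}
    (ht : t 0 = 0) {D : ℕ} (hD : 0 < D) {k : ℤ} (hk : k - D < a) :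
    expH t ((psiStar k : Alg R) • v) = creationSeries D k ((exp R).subst (mk t)) • expH t v := by
  have ht' : constantCoeff (mk t) = 0 := by
    rw [← coeff_zero_eq_constantCoeff_apply, coeff_mk, ht]
  -- The window from `a` to `max b k` accommodates both `v` and $\psi^*_kv$, so a single `N` serves
  -- for both.
  obtain ⟨N, hN⟩ := exists_H_pow_eq_zero t a (max b k - a + 1).toNat
  have h1 : (H t ^ N) v = 0 := hN v (hv.mono le_rfl (by omega))
  have h2 : (H t ^ N) ((psiStar k : Alg R) • v) = 0 :=
    hN _ ((hv.psiStar_smul k).mono le_rfl (by omega))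
  rw [expH_eq_sum h2 (Nat.le_add_left N D), creationSeries_exp_subst ht' (Nat.le_add_right D N),
    sum_smul]
  let g : ℕ → ℕ → Fock R := fun i j => algebraMap ℚ R (1 / (i.factorial : ℚ)) •
    creationSeries D k (mk t ^ i) • algebraMap ℚ R (1 / (j.factorial : ℚ)) • (H t ^ j) v
  have h3 : ∀ m ∈ range (D + N), algebraMap ℚ R (1 / (m.factorial : ℚ)) •
      (H t ^ m) ((psiStar k : Alg R) • v) =
      ∑ i ∈ range (m + 1), g i (m - i) := by
    intro m _
    rw [H_pow_psiStar_smul hv ht hD hk, smul_sum, Finset.Nat.sum_antidiagonal_eq_sum_range_succ_mk]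
    refine sum_congr rfl fun i hi => ?_
    have him : i ≤ m := by rw [mem_range] at hi; omega
    dsimp only [g]
    rw [← smul_comm (algebraMap ℚ R (1 / ((m - i).factorial : ℚ))), smul_smul,
      ← Nat.cast_smul_eq_nsmul R, smul_smul, ← map_mul, ← map_natCast (algebraMap ℚ R), ← map_mul,
      Nat.cast_choose ℚ him]
    congr 2
    have := Nat.cast_ne_zero (R := ℚ).2 m.factorial_ne_zero
    field_simp
  rw [sum_congr rfl h3, sum_range_diag_flip (D + N) g]
  refine sum_congr rfl fun i _ => ?_
  dsimp only [g]
  -- Powers of `mk t` of exponent at least `D` vanish after truncation; for $i<D$ the inner sum has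
  -- more than `N` terms and is already all of $e^{H[t]}v$.
  by_cases hi : D ≤ i
  · simp only [creationSeries_pow_eq_zero ht' hi, zero_smul, smul_zero, sum_const_zero]
  · rw [expH_eq_sum h1 (M := D + N - i) (by omega), smul_assoc, smul_sum, smul_sum]

theorem expH_eq_self {t : ℕ → R} {v : Fock R} (h : H t v = 0) : expH t v = v := by
  rw [expH_eq_sum (N := 1) (by rwa [pow_one]) le_rfl]
  simp

theorem expH_prod_psiStar_smul {n : ℕ} (k : Fin n → ℤ) {a b : ℤ} {v : Fock R}
    (hv : IsBounded a b v) {t : ℕ → R} (ht : t 0 = 0) {D : ℕ} (hD : 0 < D)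
    (hk : ∀ i, k i - D < a) :
    expH t ((List.ofFn fun i => (psiStar (k i) : Alg R)).prod • v) =
      (List.ofFn fun i => creationSeries D (k i) ((exp R).subst (mk t))).prod • expH t v := by
  -- Creation operators may raise the upper bound but preserve the lower bound `a`, so one cutoff
  -- `D` works for all factors.
  have hb : ∀ (m : ℕ) (l : Fin m → ℤ),
      ∃ b', IsBounded a b' ((List.ofFn fun i => (psiStar (l i) : Alg R)).prod • v) := by
    intro m
    induction m with
    | zero => exact fun _ => ⟨b, by simpa using hv⟩
    | succ m ih =>
      intro l
      obtain ⟨b', hb'⟩ := ih fun i => l i.succ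
      rw [List.ofFn_succ, List.prod_cons, mul_smul]
      exact ⟨_, hb'.psiStar_smul _⟩
  induction n with
  | zero => simp
  | succ n ih =>
    obtain ⟨b', hb'⟩ := hb n fun i => k i.succ
    rw [List.ofFn_succ, List.prod_cons, mul_smul, expH_psiStar_smul hb' ht hD (hk 0),
      ih _ fun i => hk i.succ, List.ofFn_succ, List.prod_cons, mul_smul]

end Fermion

/-! ### Evaluation of the matrix element. -/

namespace Fermion

open PowerSeries SuperSchur

variable {R : Type*} [CommRing R]

theorem ket_surjective : Function.Surjective (ket : Alg R → Fock R) :=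
  Submodule.Quotient.mk_surjective _

theorem smul_ket (a b : Alg R) : a • ket b = ket (a * b) := rfl

theorem bra_smul (a b : Alg R) (v : Fock R) : bra a (b • v) = bra (a * b) v := by
  obtain ⟨c, rfl⟩ := ket_surjective v
  rw [smul_ket, bra_ket, bra_ket, mul_assoc]

/-- Insert $1=\psi_{-1/2}\psi^*_{-1/2}+\psi^*_{-1/2}\psi_{-1/2}$ and use $\langle0|\psi_{-1/2}=0$.
This creates the annihilation operator belonging to $\mu_n=0$. -/
theorem bra_one_eq (v : Fock R) :
    bra (1 : Alg R) v = bra (psiStar 0 : Alg R) ((psi 0 : Alg R) • v) := by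
  obtain ⟨c, rfl⟩ := ket_surjective v
  have h := psi_mul_psiStar (R := R) 0 0
  rw [if_pos rfl] at h
  rw [smul_ket, bra_ket, bra_ket, ← h, add_mul, map_add, mul_assoc, mul_assoc,
    (vev_cr_mul 0 _).2 le_rfl, zero_add]

theorem isBounded_vacuum : IsBounded 1 0 (ket (1 : Alg R)) := by
  refine ⟨fun k hk => ?_, fun k hk => ?_⟩ <;> rw [smul_ket, mul_one] <;>
    refine (Submodule.Quotient.mk_eq_zero (annIdeal R)).2 (Ideal.subset_span ?_)
  · exact Or.inl ⟨k, by omega, rfl⟩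
  · exact Or.inr ⟨k, by omega, rfl⟩

theorem isBounded_psi_vacuum : IsBounded 0 0 ((psi 0 : Alg R) • ket (1 : Alg R)) :=
  isBounded_vacuum.psi_smul 0

theorem psi_smul_psi_vacuum {k : ℤ} (hk : 0 ≤ k) :
    (psi k : Alg R) • (psi 0 : Alg R) • ket (1 : Alg R) = 0 := by
  rcases hk.eq_or_lt with rfl | hk
  · rw [smul_smul, psi, CliffordAlgebra.ι_sq_scalar]
    simp only [quadForm_apply, map_zero, zero_smul]
  · exact isBounded_psi_vacuum.2 k hk

/-- The window of bounds consists of a single position, and each $J_q$ with $q\ge1$ would have to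
move a particle by $q$ within it. -/
theorem H_psi_vacuum (t : ℕ → R) : H t ((psi 0 : Alg R) • ket (1 : Alg R)) = 0 := by
  change ∑ᶠ q : ℕ, t (q + 1) • J (q + 1 : ℤ) ((psi 0 : Alg R) • ket (1 : Alg R)) = 0
  rw [← finsum_zero (M := Fock R) (α := ℕ)]
  refine finsum_congr fun q => ?_
  rw [J_eq_zero isBounded_psi_vacuum (by omega), smul_zero]

theorem bra_psiStar_psi_vacuum :
    bra (psiStar 0 : Alg R) ((psi 0 : Alg R) • ket (1 : Alg R)) = 1 := by
  rw [← bra_one_eq, bra_ket, mul_one, vev_one]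

theorem shiftOp_zero : shiftOp 0 = (1 : Alg R) := by
  simp [shiftOp]

theorem coshiftOp_zero : coshiftOp 0 = (1 : Alg R) := by
  simp [coshiftOp]

/-- All creation operators of the ket sit at positive positions, so $\psi_{-1/2}$ anticommutes with
each of them. -/
theorem psi_smul_partitionKet {n : ℕ} (lam : Fin n → ℕ) :
    (psi 0 : Alg R) • partitionKet lam n = (-1 : R) ^ n •
      (List.ofFn fun i : Fin n => (psiStar (n + lam i - (i : ℤ)) : Alg R)).prod •
        (psi 0 : Alg R) • ket (1 : Alg R) := by
  rw [partitionKet, sub_self, shiftOp_zero, smul_ket, mul_one, mul_prod_ofFn_of_anticommute]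
  · rw [smul_ket, smul_ket, mul_one, ← algebraMap_smul (Alg R), smul_ket, map_pow, map_neg, map_one]
  · intro q
    rw [psi_mul_psiStar, if_neg (by omega)]

theorem partitionBra_apply {n : ℕ} (mu : Fin n → ℕ) (v : Fock R) :
    partitionBra mu n v = bra (psiStar 0 : Alg R) ((List.ofFn fun i : Fin (n + 1) =>
      (psi (n + (Fin.snoc mu 0 : Fin (n + 1) → ℕ) i - (i : ℤ)) : Alg R)).reverse.prod • v) := by
  rw [partitionBra, sub_self, coshiftOp_zero, ← bra_smul, bra_one_eq, List.ofFn_succ',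
    List.concat_eq_append, List.reverse_append, List.reverse_singleton, List.prod_append,
    List.prod_singleton, mul_smul]
  simp only [Fin.snoc_castSucc, Fin.snoc_last, Fin.val_castSucc, Fin.val_last, Nat.cast_zero,
    add_zero, sub_self]

variable [Algebra ℚ R]

theorem partitionBra_expH_psi_smul_partitionKet (x y : R) (n : ℕ) (lam : Fin (n + 1) → ℕ)
    (mu : Fin n → ℕ) :
    partitionBra mu (n : ℤ) (expH (superTime x y)
        ((psi 0 : Alg R) • partitionKet lam ((n : ℤ) + 1))) =
      (-1) ^ (n + 1) * (Matrix.of fun p q : Fin (n + 1) => superH ![x] ![y]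
        ((lam q : ℤ) - ((Fin.snoc mu 0 : Fin (n + 1) → ℕ) p : ℤ) - (q : ℤ) + (p : ℤ) + 1)).det := by
  -- A common cutoff above all positions in the ket: it satisfies the bounds both for moving
  -- $e^{H[s]}$ through and for the contractions with the bra.
  obtain ⟨D, hD0, hD⟩ : ∃ D : ℕ, 0 < D ∧ ∀ q : Fin (n + 1),
      ((n + 1 : ℕ) : ℤ) + lam q - (q : ℤ) < D := by
    refine ⟨n + 2 + ∑ q, lam q, by omega, fun q => ?_⟩
    have := Finset.single_le_sum (f := lam) (fun _ _ => Nat.zero_le _) (Finset.mem_univ q)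
    omega
  have hket := psi_smul_partitionKet (R := R) lam
  rw [Nat.cast_add, Nat.cast_one] at hket
  rw [hket, map_smul, map_smul, smul_eq_mul, partitionBra_apply,
    expH_prod_psiStar_smul _ isBounded_psi_vacuum (superTime_zero x y) hD0 fun q => by
      have := hD q
      push_cast at this
      omega,
    expH_eq_self (H_psi_vacuum _), exp_subst_superTime,
    prod_reverse_smul_prod_smul (R := R) _ _ (Matrix.of fun p q : Fin (n + 1) => superH ![x] ![y]
        ((lam q : ℤ) - ((Fin.snoc mu 0 : Fin (n + 1) → ℕ) p : ℤ) - (q : ℤ) + (p : ℤ) + 1)),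
    map_smul, bra_psiStar_psi_vacuum, smul_eq_mul, mul_one]
  -- The entry is $h_k$ at the difference of positions $(n+1+\lambda_q-q)-(n+\mu_p-p)$, where
  -- negative differences give zero on both sides.
  · intro p q
    have := hD q
    rw [psi_mul_creationSeries _ _ _ (by push_cast at this; omega), Matrix.of_apply]
    congr 1
    split_ifs with h
    · rw [superH_of_neg _ _ (by omega)]
    · rw [coeff_mk]
      congr 1
      omega
  · intro p
    exact psi_smul_psi_vacuum (by omega)

end Fermion

/-- The number of parts $n\ge1$ of the proposition is `n + 1` here, and `Fin.snoc mu 0` appends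
$\mu_n=0$. -/
theorem mainTheorem6 {R : Type*} [CommRing R] [Algebra ℚ R] (x y : R) (n : ℕ)
    (lam : Fin (n + 1) → ℕ) (mu : Fin n → ℕ) (hlam : Antitone lam) (hmu : Antitone mu) :
    (Fermion.partitionBra mu (n : ℤ)
        (Fermion.expH (Fermion.superTime x y)
          ((Fermion.psi 0 : Fermion.Alg R) • Fermion.partitionKet lam ((n : ℤ) + 1))) =
      (-1) ^ (n + 1) *
        SuperSchur.superSchur (fun q => lam q + 1) (Fin.snoc mu 0 : Fin (n + 1) → ℕ) ![x] ![y]) ∧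
    (SuperSchur.superSchur (fun q => lam q + 1) (Fin.snoc mu 0 : Fin (n + 1) → ℕ) ![x] ![y] =
      (Matrix.of fun p q : Fin (n + 1) =>
        SuperSchur.superH ![x] ![y]
          ((lam q : ℤ) - ((Fin.snoc mu 0 : Fin (n + 1) → ℕ) p : ℤ)
            - (q : ℤ) + (p : ℤ) + 1)).det) ∧
    (∀ t : R, y = t * x → ∀ q : ℕ, 1 ≤ q →
      Fermion.superTime x y q = Fermion.sPlus ![x] ![t] q) := by
  have hsnoc : Antitone (Fin.snoc mu 0 : Fin (n + 1) → ℕ) := by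
    intro i j hij
    induction j using Fin.lastCases with
    | last => simp
    | cast j =>
      induction i using Fin.lastCases with
      | last => exact absurd hij (Fin.castSucc_lt_last j).not_ge
      | cast i => simpa using hmu (Fin.castSucc_le_castSucc_iff.1 hij)
  have hdet := SuperSchur.superSchur_eq_det x y (lam := fun q => lam q + 1)
    (fun i j hij => Nat.add_le_add_right (hlam hij) 1) hsnoc
  have hdet' : SuperSchur.superSchur (fun q => lam q + 1) (Fin.snoc mu 0 : Fin (n + 1) → ℕ)
      ![x] ![y] = (Matrix.of fun p q : Fin (n + 1) =>
        SuperSchur.superH ![x] ![y] ((lam q : ℤ) - ((Fin.snoc mu 0 : Fin (n + 1) → ℕ) p : ℤ)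
          - (q : ℤ) + (p : ℤ) + 1)).det := by
    rw [hdet]
    congr 1
    ext p q
    simp only [Matrix.of_apply]
    congr 1
    push_cast
    ring
  refine ⟨?_, hdet', ?_⟩
  · rw [hdet', Fermion.partitionBra_expH_psi_smul_partitionKet]
  · rintro t rfl q -
    exact Fermion.superTime_mul_self x t q
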